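/- Fix a field $\Bbbk$ and an integer $n\ge 2$. An $n$-parameter persistence module is a functor $M:\mathbf R^n\to\mathbf{vec}$ from the poset $\mathbf R^n$ (with the product order) to the category of finite-dimensional $\Bbbk$-vector spaces; morphisms are natural transformations. For $i\in\mathbf R^n$ let $\mathsf P_i$ be the module that is $\Bbbk$ at every $j\ge i$ and $0$ elsewhere, with identity structure morphisms between copies of $\Bbbk$. A module is finitely presentable if it is isomorphic to the cokernel of a morphism between finite direct sums of modules of the form $\mathsf P_i$. A module is indecomposable if it is non-zero and not isomorphic to a direct sum of two non-zero persistence modules. For $r\in\mathbb R$ let $M[r]$ be the shifted module $M[r](s)=M(s+(r,\dots,r))$, and for $r\ge 0$ let $\eta^M_r:M\to M[r]$ be the morphism given by the structure morphisms of $M$. For $\epsilon\ge 0$, an $\epsilon$-interleaving between $M$ and $N$ is a pair of morphisms $f:M\to N[\epsilon]$, $g:N\to M[\epsilon]$ with $g[\epsilon]\circ f=\eta^M_{2\epsilon}$ and $f[\epsilon]\circ g=\eta^N_{2\epsilon}$. The interleaving distance $d_I(M,N)\in[0,\infty]$ is the infimum of all $\epsilon\ge0$ for which an $\epsilon$-interleaving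 exists ($\infty$ if there is none). Equip the set of isomorphism classes of finitely presentable $n$-parameter persistence modules with the topology generated by the open balls of $d_I$; closure, interior and density refer to this space. Let $\mathcal F$ be any set of isomorphism classes of indecomposable, finitely presentable $n$-parameter persistence modules. Call a finitely presentable module $\mathcal F$-decomposable if it is isomorphic to a finite (possibly empty) direct sum of modules whose isomorphism classes belong to $\mathcal F$, and let $\mathcal G$ be the set of isomorphism classes of $\mathcal F$-decomposable modules. Then $$\operatorname{int}\bigl(\overline{\mathcal G}\bigr)=\operatorname{int}\bigl(\overline{\mathcal F}\bigr).$$ In particular, if $\mathcal G$ is dense, then $\mathcal F$ is dense. -/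

import Mathlib

open CategoryTheory CategoryTheory.Limits
open scoped NNReal ENNReal

universe u

noncomputable section

/-- The poset `ℝⁿ` with the product (coordinatewise) order, regarded as a category below.
(A separate name is used so that the category structure is the one given by the order.) -/
def RPoset (n : ℕ) : Type := Fin n → ℝ

instance (n : ℕ) : PartialOrder (RPoset n) := inferInstanceAs (PartialOrder (Fin n → ℝ))

/-- `n`-parameter (pointwise finite dimensional) persistence modules over the field `K`:
functors from the poset `ℝⁿ` to finite dimensional `K`-vector spaces. -/
abbrev PersMod (K : Type u) [Field K] (n : ℕ) := RPoset n ⥤ FGModuleCat.{u} K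

namespace PersMod

instance (K : Type u) [Field K] (n : ℕ) : HasFiniteBiproducts (PersMod K n) :=
  Abelian.hasFiniteBiproducts

/-- `s + r`, where the real number `r` is added to all the coordinates of `s`. -/
def addDiag {n : ℕ} (s : RPoset n) (r : ℝ) : RPoset n := fun k => s k + r

lemma addDiag_mono {n : ℕ} (r : ℝ) : Monotone (fun s : RPoset n => addDiag s r) :=
  fun _ _ h k => add_le_add_left (h k) r

lemma le_addDiag {n : ℕ} (s : RPoset n) (r : ℝ≥0) : s ≤ addDiag s r :=
  fun k => le_add_of_nonneg_right (a := s k) r.coe_nonneg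

variable (K : Type u) [Field K] {n : ℕ}

/-- The values of the module `P_i`: it is `K` at every `j ≥ i` and `0` elsewhere, and its structure morphisms
are the identity of `K` wherever source and target are `K`.  The spaces are realised as the
subspaces `⊤` and `⊥` of `K`, and the structure morphisms as inclusions of subspaces. -/
def freeSub (i j : RPoset n) : Submodule K K :=
  open Classical in if i ≤ j then ⊤ else ⊥

lemma freeSub_mono (i : RPoset n) {j k : RPoset n} (h : j ≤ k) :
    freeSub K i j ≤ freeSub K i k := by
  unfold freeSub
  by_cases hij : i ≤ j
  · simp [hij, hij.trans h]
  · simp [hij]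

/-- The persistence module `P_i`, with `P_i(j) = freeSub K i j`. -/
def free (i : RPoset n) : PersMod K n where
  obj j := FGModuleCat.of K (freeSub K i j)
  map h := FGModuleCat.ofHom (Submodule.inclusion (freeSub_mono K i (leOfHom h)))
  map_id _ := rfl
  map_comp _ _ := rfl

variable {K}

/-- `M` is finitely presentable: it is isomorphic to the cokernel of a morphism
`⨁_j P_{b j} ⟶ ⨁_i P_{a i}` between finite direct sums. -/
def IsFP (M : PersMod K n) : Prop :=
  ∃ (p q : ℕ) (a : Fin p → RPoset n) (b : Fin q → RPoset n)
    (f : (⨁ fun j => free K (b j)) ⟶ (⨁ fun i => free K (a i))),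
    Nonempty (M ≅ cokernel f)

/-- The `r`-shift `M[r]` of `M`, with `M[r](s) = M(s + r)` and the corresponding structure
morphisms. -/
abbrev shift (r : ℝ) (M : PersMod K n) : PersMod K n where
  obj s := M.obj (addDiag s r)
  map h := M.map (homOfLE (addDiag_mono r (leOfHom h)))
  map_id _ := M.map_id _
  map_comp _ _ := M.map_comp _ _

/-- `f : M ⟶ N[ε]` and `g : N ⟶ M[ε]` satisfy `g[ε] ∘ f = η^M_{2ε}`: at every `s`, the composite
`M(s) ⟶ N(s + ε) ⟶ M(s + ε + ε)` is the structure morphism of `M`. -/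
def IsTriangle {M N : PersMod K n} {ε : ℝ≥0} (f : M ⟶ shift ε N) (g : N ⟶ shift ε M) : Prop :=
  ∀ s : RPoset n, f.app s ≫ g.app (addDiag s ε) =
    M.map (homOfLE ((le_addDiag s ε).trans (le_addDiag (addDiag s ε) ε)))

/-- `M` and `N` are `ε`-interleaved. -/
def Interleaved (ε : ℝ≥0) (M N : PersMod K n) : Prop :=
  ∃ (f : M ⟶ shift ε N) (g : N ⟶ shift ε M), IsTriangle f g ∧ IsTriangle g f

/-- The interleaving distance (`∞` if there is no interleaving). -/
def dI (M N : PersMod K n) : ℝ≥0∞ :=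
  ⨅ (ε : ℝ≥0) (_ : Interleaved ε M N), (ε : ℝ≥0∞)

lemma Interleaved.congr {M M' N N' : PersMod K n} {ε : ℝ≥0} (e : M ≅ M') (e' : N ≅ N')
    (h : Interleaved ε M N) : Interleaved ε M' N' := by
  obtain ⟨f, g, h1, h2⟩ := h
  refine ⟨⟨fun s => e.inv.app s ≫ f.app s ≫ e'.hom.app (addDiag s ε), ?_⟩,
    ⟨fun s => e'.inv.app s ≫ g.app s ≫ e.hom.app (addDiag s ε), ?_⟩, ?_, ?_⟩
  · intro s t h
    have hf := f.naturality_assoc h (e'.hom.app (addDiag t ε))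
    simp_all
  · intro s t h
    have hg := g.naturality_assoc h (e.hom.app (addDiag t ε))
    simp_all
  · intro s
    have := reassoc_of% (h1 s)
    simp [this]
  · intro s
    have := reassoc_of% (h2 s)
    simp [this]

lemma dI_congr {M M' N N' : PersMod K n} (e : M ≅ M') (e' : N ≅ N') : dI M N = dI M' N' := by
  have (ε : ℝ≥0) : Interleaved ε M N ↔ Interleaved ε M' N' :=
    ⟨fun h => h.congr e e', fun h => h.congr e.symm e'.symm⟩
  simp only [dI, this]

end PersMod

/-- The isomorphism relation on finitely presentable `n`-parameter persistence modules. -/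
def fpSetoid (K : Type u) [Field K] (n : ℕ) : Setoid {M : PersMod K n // M.IsFP} where
  r M N := Nonempty (M.1 ≅ N.1)
  iseqv := ⟨fun _ => ⟨Iso.refl _⟩, fun ⟨e⟩ => ⟨e.symm⟩, fun ⟨e⟩ ⟨e'⟩ => ⟨e ≪≫ e'⟩⟩

/-- The set of isomorphism classes of finitely presentable `n`-parameter persistence modules. -/
def FPSpace (K : Type u) [Field K] (n : ℕ) := Quotient (fpSetoid K n)

namespace FPSpace

variable {K : Type u} [Field K] {n : ℕ}

/-- The isomorphism class of a finitely presentable module. -/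
def mk (M : PersMod K n) (hM : M.IsFP) : FPSpace K n := Quotient.mk (fpSetoid K n) ⟨M, hM⟩

/-- The interleaving distance on isomorphism classes. -/
def dist (x y : FPSpace K n) : ℝ≥0∞ :=
  Quotient.liftOn₂ (s₁ := fpSetoid K n) (s₂ := fpSetoid K n) x y (fun M N => PersMod.dI M.1 N.1)
    (fun _ _ _ _ ⟨e⟩ ⟨e'⟩ => PersMod.dI_congr e e')

/-- The topology generated by the open balls with respect to the interleaving distance. -/
instance : TopologicalSpace (FPSpace K n) :=
  TopologicalSpace.generateFrom
    {B | ∃ (x : FPSpace K n) (r : ℝ≥0), 0 < r ∧ B = {y | dist x y < r}}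

/-- `x` is the isomorphism class of a module that is indecomposable (non-zero, and not
isomorphic to a direct sum of two non-zero persistence modules). -/
def IsIndecomposable (x : FPSpace K n) : Prop :=
  ∃ (M : PersMod K n) (hM : M.IsFP), mk M hM = x ∧ Indecomposable M

/-- The isomorphism classes of the `F`-decomposable modules: the finitely presentable modules
isomorphic to a finite direct sum of modules whose isomorphism classes lie in `F`
(the empty direct sum, which is the zero module, is included). -/
def decomposables (F : Set (FPSpace K n)) : Set (FPSpace K n) :=
  {x | ∃ (M : PersMod K n) (hM : M.IsFP), mk M hM = x ∧
    ∃ (k : ℕ) (X : Fin k → PersMod K n),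
      (∀ i, ∃ hX : (X i).IsFP, mk (X i) hX ∈ F) ∧ Nonempty (M ≅ ⨁ X)}

end FPSpace

end

/-! Since `F ⊆ decomposables F`, it suffices that every interior point of the closure of the
decomposables lies in the closure of `F`. Two facts give this: modules that are indecomposable in a
robust way are dense, and if such a module is close to a direct sum, then it is close to a single
summand.

Robustness (`Presentation.exists_interleaved_summand`). Let `M` be finitely presented and non-zero,
with only trivial idempotents, and let `f`, `g` be an `ε`-interleaving with `N = ⨁ X l`. The maps `ψ
l = g ∘ q l ∘ p l ∘ f : M ⟶ M[2ε]`, where `q l ∘ p l` projects onto `X l`, add up to the structure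
morphism. If `ε` is small compared with the gaps between the degrees of the presentation, they lift
to endomorphisms `φ l` of `M`. Because `f ∘ g` is a structure morphism, the `φ l` are idempotent.
They cannot all vanish, so some `φ l` is the identity, and then `p l ∘ f` and `g ∘ q l` interleave
`M` with `X l`.

Density (`Presentation.tack`, `exists_tackData`). Given a presentation, each generator is doubled
into `p i`, `q i`, a short-lived generator `k i` is added, and the relations `q i - p i + k i = 0`
and `∑ k i = 0` are imposed in degrees where they are the only relations seen by the coordinates
concerned. All changes die within `ε`, so the module moves by at most `ε`. Yet the new relations
force all diagonal entries of the matrix of an endomorphism to agree. For an idempotent this common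
value is `0` or `1`; the generators have distinct degrees, so the matrix is triangular and the
idempotent is `0` or the identity. Placing the degrees as required uses two coordinates, hence `2 ≤
n`. -/

noncomputable section

/-! ### Elementwise calculus in persistence modules -/

namespace PersMod

variable {K : Type u} [Field K] {n : ℕ}

/-- The structure morphisms of a persistence module, as linear maps. -/
def tr (N : PersMod K n) {s t : RPoset n} (h : s ≤ t) : N.obj s →ₗ[K] N.obj t :=
  (N.map (homOfLE h)).hom.hom

/-- The components of a morphism of persistence modules, as linear maps. -/
def ap {M N : PersMod K n} (f : M ⟶ N) (s : RPoset n) : M.obj s →ₗ[K] N.obj s :=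
  (f.app s).hom.hom

@[simp] lemma tr_refl (N : PersMod K n) {s : RPoset n} (h : s ≤ s) (x : N.obj s) :
    N.tr h x = x :=
  LinearMap.congr_fun (congrArg (fun f => f.hom.hom) (N.map_id s)) x

@[simp] lemma tr_tr (N : PersMod K n) {s t r : RPoset n} (h : s ≤ t) (h' : t ≤ r) (x : N.obj s) :
    N.tr h' (N.tr h x) = N.tr (h.trans h') x :=
  (LinearMap.congr_fun (congrArg (fun f => f.hom.hom)
    (N.map_comp (homOfLE h) (homOfLE h'))) x).symm

lemma ap_tr {M N : PersMod K n} (f : M ⟶ N) {s t : RPoset n} (h : s ≤ t) (x : M.obj s) :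
    ap f t (M.tr h x) = N.tr h (ap f s x) :=
  LinearMap.congr_fun (congrArg (fun f => f.hom.hom) (f.naturality (homOfLE h))) x

@[simp] lemma ap_comp {M N P : PersMod K n} (f : M ⟶ N) (g : N ⟶ P) (s : RPoset n) (x : M.obj s) :
    ap (f ≫ g) s x = ap g s (ap f s x) := rfl

@[simp] lemma ap_id (M : PersMod K n) (s : RPoset n) (x : M.obj s) : ap (𝟙 M) s x = x := rfl

@[simp] lemma ap_zero {M N : PersMod K n} (s : RPoset n) : ap (0 : M ⟶ N) s = 0 := rfl

lemma ap_sum {ι : Type*} {M N : PersMod K n} (t : Finset ι) (f : ι → (M ⟶ N)) (s : RPoset n) :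
    ap (∑ i ∈ t, f i) s = ∑ i ∈ t, ap (f i) s := by
  classical
  induction t using Finset.induction_on with
  | empty => simp
  | insert i t hi ih =>
    rw [Finset.sum_insert hi, Finset.sum_insert hi, ← ih]
    rfl

lemma hom_ext_ap {M N : PersMod K n} {f g : M ⟶ N} (h : ∀ s x, ap f s x = ap g s x) : f = g := by
  ext s x
  exact h s x

/-- A morphism of persistence modules from its components. -/
def homMk {M N : PersMod K n} (f : ∀ s, M.obj s →ₗ[K] N.obj s)
    (hf : ∀ s t (h : s ≤ t) x, f t (M.tr h x) = N.tr h (f s x)) : M ⟶ N where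
  app s := ConcreteCategory.ofHom (f s)
  naturality s t h := by
    ext x
    exact hf s t (leOfHom h) x

@[simp] lemma ap_homMk {M N : PersMod K n} (f : ∀ s, M.obj s →ₗ[K] N.obj s)
    (hf : ∀ s t (h : s ≤ t) x, f t (M.tr h x) = N.tr h (f s x)) (s : RPoset n) :
    ap (homMk f hf) s = f s := rfl

lemma tr_shift (N : PersMod K n) (r : ℝ) {s t : RPoset n} (h : s ≤ t) :
    (shift r N).tr h = N.tr (addDiag_mono r h) := rfl

lemma isTriangle_iff {M N : PersMod K n} {ε : ℝ≥0} (f : M ⟶ shift ε N) (g : N ⟶ shift ε M) :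
    IsTriangle f g ↔ ∀ s (x : M.obj s), ap g (addDiag s ε) (ap f s x) =
      M.tr ((le_addDiag s ε).trans (le_addDiag (addDiag s ε) ε)) x := by
  refine forall_congr' fun s => ⟨fun h x => ?_, fun h => ?_⟩
  · exact LinearMap.congr_fun (congrArg (fun f => f.hom.hom) h) x
  · ext x
    exact h x

/-- The image of `x ∈ N(a)` in `N(s)`; it is `0` unless `a ≤ s`. -/
def push (N : PersMod K n) {a : RPoset n} (x : N.obj a) (s : RPoset n) : N.obj s :=
  open Classical in if h : a ≤ s then N.tr h x else 0

lemma push_of_le (N : PersMod K n) {a s : RPoset n} (h : a ≤ s) (x : N.obj a) :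
    N.push x s = N.tr h x := by simp [push, h]

@[simp] lemma push_self (N : PersMod K n) {a : RPoset n} (x : N.obj a) : N.push x a = x := by
  rw [push_of_le N le_rfl, tr_refl]

lemma ap_push {M N : PersMod K n} (f : M ⟶ N) {a : RPoset n} (x : M.obj a) (s : RPoset n) :
    ap f s (M.push x s) = N.push (ap f a x) s := by
  by_cases h : a ≤ s
  · rw [push_of_le _ h, push_of_le _ h, ap_tr]
  · simp [push, h]

lemma tr_push (N : PersMod K n) {a s t : RPoset n} (h : s ≤ t) (ha : a ≤ s) (x : N.obj a) :
    N.tr h (N.push x s) = N.push x t := by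
  rw [push_of_le _ ha, push_of_le _ (ha.trans h), tr_tr]

/-! ### Modules given by generators and relations -/

variable {ι κ : Type}

/-- The vectors whose support consists of indices `i` with `a i ≤ s`. -/
def below (K : Type u) [Field K] (a : ι → RPoset n) (s : RPoset n) : Submodule K (ι → K) where
  carrier := {v | ∀ i, v i ≠ 0 → a i ≤ s}
  zero_mem' := by simp
  add_mem' {v w} hv hw i hi := by
    by_cases h : v i = 0
    · exact hw i (by simpa [h] using hi)
    · exact hv i h
  smul_mem' c v hv i hi := hv i (by simp at hi; exact hi.2)

lemma below_mono (a : ι → RPoset n) {s t : RPoset n} (h : s ≤ t) : below K a s ≤ below K a t :=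
  fun _ hv i hi => (hv i hi).trans h

lemma single_mem_below [DecidableEq ι] (a : ι → RPoset n) {s : RPoset n} {i : ι} (h : a i ≤ s)
    (c : K) : Pi.single i c ∈ below K a s := by
  intro j hj
  by_cases hij : j = i
  · exact hij ▸ h
  · simp [hij] at hj

/-- A finite presentation: generators of degrees `deg i`, and relations `rel j` of degrees
`rdeg j`. -/
structure Presentation (K : Type u) [Field K] (n : ℕ) (ι κ : Type) where
  deg : ι → RPoset n
  rdeg : κ → RPoset n
  rel : κ → ι → K
  rel_mem : ∀ j, rel j ∈ below K deg (rdeg j)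

namespace Presentation

variable (D : Presentation K n ι κ)

/-- The relations in degree `s`. -/
def rels (s : RPoset n) : Submodule K (ι → K) :=
  Submodule.span K (D.rel '' {j | D.rdeg j ≤ s})

lemma rels_mono {s t : RPoset n} (h : s ≤ t) : D.rels s ≤ D.rels t :=
  Submodule.span_mono (Set.image_mono fun _ hj => le_trans hj h)

lemma rel_mem_rels {j : κ} {s : RPoset n} (h : D.rdeg j ≤ s) : D.rel j ∈ D.rels s :=
  Submodule.subset_span ⟨j, h, rfl⟩

lemma rels_le {s : RPoset n} {V : Submodule K (ι → K)}
    (h : ∀ j, D.rdeg j ≤ s → D.rel j ∈ V) : D.rels s ≤ V :=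
  Submodule.span_le.2 (by rintro _ ⟨j, hj, rfl⟩; exact h j hj)

end Presentation

variable [Fintype ι]

/-- The linear combination in `N(s)` of elements `x i ∈ N(a i)`. -/
def comb (N : PersMod K n) {a : ι → RPoset n} (x : ∀ i, N.obj (a i)) (s : RPoset n) :
    (ι → K) →ₗ[K] N.obj s :=
  Fintype.linearCombination K fun i => N.push (x i) s

lemma comb_apply (N : PersMod K n) {a : ι → RPoset n} (x : ∀ i, N.obj (a i)) (s : RPoset n)
    (v : ι → K) : N.comb x s v = ∑ i, v i • N.push (x i) s := rfl

lemma ap_comb {M N : PersMod K n} (f : M ⟶ N) {a : ι → RPoset n} (x : ∀ i, M.obj (a i))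
    (s : RPoset n) (v : ι → K) :
    ap f s (M.comb x s v) = N.comb (fun i => ap f _ (x i)) s v := by
  simp [comb_apply, ap_push]

lemma tr_comb (N : PersMod K n) {a : ι → RPoset n} (x : ∀ i, N.obj (a i)) {s t : RPoset n}
    (h : s ≤ t) {v : ι → K} (hv : v ∈ below K a s) :
    N.tr h (N.comb x s v) = N.comb x t v := by
  simp only [comb_apply, map_sum, map_smul]
  refine Finset.sum_congr rfl fun i _ => ?_
  by_cases hi : v i = 0
  · simp [hi]
  · rw [tr_push N h (hv i hi)]

@[simp] lemma comb_single [DecidableEq ι] (N : PersMod K n) {a : ι → RPoset n}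
    (x : ∀ i, N.obj (a i)) (s : RPoset n) (i : ι) (c : K) :
    N.comb x s (Pi.single i c) = c • N.push (x i) s := by
  simp [comb, Fintype.linearCombination_apply_single]

namespace Presentation

variable (D : Presentation K n ι κ)

/-- The persistence module with the given presentation. -/
def toPersMod : PersMod K n where
  obj s := FGModuleCat.of K (below K D.deg s ⧸ (D.rels s).submoduleOf (below K D.deg s))
  map {s t} h := FGModuleCat.ofHom (Submodule.mapQ _ _
    (Submodule.inclusion (below_mono D.deg (leOfHom h)))
    (fun _ hv => D.rels_mono (leOfHom h) hv))
  map_id s := by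
    ext x
    rfl
  map_comp f g := by
    ext x
    rfl

/-- The class of a vector in the module with the given presentation. -/
def cls (s : RPoset n) : below K D.deg s →ₗ[K] D.toPersMod.obj s :=
  Submodule.mkQ ((D.rels s).submoduleOf (below K D.deg s))

lemma cls_surjective (s : RPoset n) : Function.Surjective (D.cls s) :=
  Submodule.mkQ_surjective _

lemma cls_eq_zero_iff {s : RPoset n} (v : below K D.deg s) :
    D.cls s v = 0 ↔ (v : ι → K) ∈ D.rels s :=
  Submodule.Quotient.mk_eq_zero _

lemma tr_cls {s t : RPoset n} (h : s ≤ t) (v : below K D.deg s) :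
    D.toPersMod.tr h (D.cls s v) = D.cls t ⟨v, below_mono _ h v.2⟩ := rfl

/-- The generators of the module with the given presentation. -/
def gen (i : ι) : D.toPersMod.obj (D.deg i) :=
  open Classical in D.cls (D.deg i) ⟨Pi.single i 1, single_mem_below _ le_rfl _⟩

lemma cls_eq_comb {s : RPoset n} (v : below K D.deg s) :
    D.cls s v = D.toPersMod.comb D.gen s v := by
  classical
  have key (i : ι) : (v : ι → K) i • D.toPersMod.push (D.gen i) s =
      D.cls s ⟨Pi.single i ((v : ι → K) i), by
        by_cases h : (v : ι → K) i = 0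
        · simp [h]
        · exact single_mem_below _ (v.2 i h) _⟩ := by
    by_cases h : (v : ι → K) i = 0
    · simp only [h, zero_smul]
      symm
      rw [cls_eq_zero_iff]
      simp
    · rw [push_of_le _ (v.2 i h), gen, tr_cls, ← map_smul]
      congr 1
      ext j
      simp [Pi.single_apply]
  rw [comb_apply, Finset.sum_congr rfl fun i _ => key i, ← map_sum]
  congr 1
  ext j
  simp [Finset.sum_apply, Pi.single_apply]

lemma comb_gen_surjective {s : RPoset n} (x : D.toPersMod.obj s) :
    ∃ v ∈ below K D.deg s, D.toPersMod.comb D.gen s v = x := by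
  obtain ⟨v, rfl⟩ := D.cls_surjective s x
  exact ⟨v, v.2, (D.cls_eq_comb v).symm⟩

lemma comb_gen_eq_zero_iff {s : RPoset n} {v : ι → K} (hv : v ∈ below K D.deg s) :
    D.toPersMod.comb D.gen s v = 0 ↔ v ∈ D.rels s := by
  rw [← D.cls_eq_zero_iff ⟨v, hv⟩, D.cls_eq_comb]

lemma comb_rel (j : κ) : D.toPersMod.comb D.gen (D.rdeg j) (D.rel j) = 0 :=
  (D.comb_gen_eq_zero_iff (D.rel_mem j)).2 (D.rel_mem_rels le_rfl)

lemma hom_ext {N : PersMod K n} {f g : D.toPersMod ⟶ N}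
    (h : ∀ i, ap f _ (D.gen i) = ap g _ (D.gen i)) : f = g := by
  refine hom_ext_ap fun s x => ?_
  obtain ⟨v, -, rfl⟩ := D.comb_gen_surjective x
  simp [ap_comb, h]

lemma comb_eq_zero_of_mem_rels {N : PersMod K n} (x : ∀ i, N.obj (D.deg i))
    (hx : ∀ j, N.comb x (D.rdeg j) (D.rel j) = 0) {s : RPoset n} {v : ι → K}
    (hv : v ∈ D.rels s) : N.comb x s v = 0 := by
  have : D.rels s ≤ LinearMap.ker (N.comb x s) := D.rels_le fun j hj => by
    rw [LinearMap.mem_ker, ← N.tr_comb x hj (D.rel_mem j), hx, map_zero]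
  exact this hv

/-- The morphism determined by images of the generators that satisfy the relations. -/
def desc {N : PersMod K n} (x : ∀ i, N.obj (D.deg i))
    (hx : ∀ j, N.comb x (D.rdeg j) (D.rel j) = 0) : D.toPersMod ⟶ N :=
  homMk (fun s => Submodule.liftQ ((D.rels s).submoduleOf (below K D.deg s))
    ((N.comb x s).comp (below K D.deg s).subtype)
    (fun _ hv => D.comb_eq_zero_of_mem_rels x hx hv)) fun s t h y => by
      obtain ⟨v, rfl⟩ := D.cls_surjective s y
      exact (N.tr_comb x h v.2).symm

@[simp] lemma desc_gen {N : PersMod K n} (x : ∀ i, N.obj (D.deg i))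
    (hx : ∀ j, N.comb x (D.rdeg j) (D.rel j) = 0) (i : ι) :
    ap (D.desc x hx) _ (D.gen i) = x i := by
  classical
  have : ap (D.desc x hx) _ (D.gen i) = N.comb x (D.deg i) (Pi.single i 1) := rfl
  simp [this]

end Presentation

end PersMod

/-! ### Free modules, and presentations of finitely presentable modules -/

namespace PersMod

variable {K : Type u} [Field K] {n : ℕ}

lemma mem_freeSub_of_le {i j : RPoset n} (h : i ≤ j) (c : K) : c ∈ freeSub K i j := by
  simp [freeSub, h]

/-- The generator of `P_i`. -/
def freeGen (i : RPoset n) : (free K i).obj i :=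
  (⟨1, mem_freeSub_of_le le_rfl 1⟩ : freeSub K i i)

/-- An element of `P_i(j)`, as a scalar. -/
def freeCoeff (i j : RPoset n) : (free K i).obj j →ₗ[K] K :=
  (freeSub K i j).subtype

lemma freeCoeff_injective (i j : RPoset n) : Function.Injective (freeCoeff (K := K) i j) :=
  Subtype.val_injective

lemma freeCoeff_ne_zero {i j : RPoset n} {x : (free K i).obj j} (h : freeCoeff i j x ≠ 0) :
    i ≤ j := by
  by_contra hij
  have hx : freeCoeff i j x ∈ freeSub K i j := Subtype.property (p := (· ∈ freeSub K i j)) x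
  simp only [freeSub, hij, if_false, Submodule.mem_bot] at hx
  exact h hx

lemma freeCoeff_push_freeGen {i j : RPoset n} (h : i ≤ j) :
    freeCoeff i j ((free K i).push (freeGen i) j) = 1 := by
  rw [push_of_le _ h]
  rfl

lemma eq_smul_push_freeGen {i j : RPoset n} (x : (free K i).obj j) :
    x = freeCoeff i j x • (free K i).push (freeGen i) j := by
  apply freeCoeff_injective
  rw [map_smul]
  by_cases h : i ≤ j
  · rw [freeCoeff_push_freeGen h, smul_eq_mul, mul_one]
  · have : freeCoeff i j x = 0 := by
      by_contra h'
      exact h (freeCoeff_ne_zero h')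
    simp [this]

lemma freeCoeff_tr {i j k : RPoset n} (h : j ≤ k) (x : (free K i).obj j) :
    freeCoeff i k ((free K i).tr h x) = freeCoeff i j x := rfl

/-- The morphism from `P_i` determined by the image of the generator. -/
def freeDesc {N : PersMod K n} {i : RPoset n} (y : N.obj i) : free K i ⟶ N :=
  homMk (fun s => (freeCoeff i s).smulRight (N.push y s)) fun s t h x => by
    simp only [LinearMap.smulRight_apply, freeCoeff_tr, map_smul]
    by_cases hx : freeCoeff i s x = 0
    · simp [hx]
    · rw [tr_push N h (freeCoeff_ne_zero hx)]

@[simp] lemma freeDesc_freeGen {N : PersMod K n} {i : RPoset n} (y : N.obj i) :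
    ap (freeDesc y) i (freeGen i) = y := by
  have : freeCoeff i i (freeGen (K := K) i) = 1 := rfl
  simp [freeDesc, this]

lemma free_hom_ext {N : PersMod K n} {i : RPoset n} {f g : free K i ⟶ N}
    (h : ap f i (freeGen i) = ap g i (freeGen i)) : f = g := by
  refine hom_ext_ap fun s x => ?_
  rw [eq_smul_push_freeGen x, map_smul, map_smul, ap_push, ap_push, h]

section Biproduct

variable {p : ℕ} (a : Fin p → RPoset n)

/-- The generators of a finite direct sum of modules `P_{a i}`. -/
def sumGen (i : Fin p) : (⨁ fun i => free K (a i)).obj (a i) :=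
  ap (biproduct.ι (fun i => free K (a i)) i) (a i) (freeGen (a i))

lemma exists_comb_sumGen {s : RPoset n} (y : (⨁ fun i => free K (a i)).obj s) :
    ∃ v ∈ below K a s, comb _ (sumGen (K := K) a) s v = y := by
  refine ⟨fun i => freeCoeff (a i) s (ap (biproduct.π (fun i => free K (a i)) i) s y),
    fun i hi => freeCoeff_ne_zero hi, ?_⟩
  have h : ap (∑ i, biproduct.π (fun i => free K (a i)) i ≫
      biproduct.ι (fun i => free K (a i)) i) s y = y := by
    rw [biproduct.total]
    rfl
  rw [ap_sum, LinearMap.sum_apply] at h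
  refine Eq.trans ?_ h
  rw [comb_apply]
  refine Finset.sum_congr rfl fun i _ => ?_
  refine Eq.trans ?_ (congrArg (ap (biproduct.ι (fun i => free K (a i)) i) s)
    (eq_smul_push_freeGen (ap (biproduct.π (fun i => free K (a i)) i) s y)).symm)
  rw [LinearMap.map_smul, ap_push]
  rfl

lemma sum_hom_ext {N : PersMod K n} {f g : (⨁ fun i => free K (a i)) ⟶ N}
    (h : ∀ i, ap f _ (sumGen a i) = ap g _ (sumGen a i)) : f = g :=
  biproduct.hom_ext' _ _ fun i => free_hom_ext (h i)

/-- The morphism from a direct sum of modules `P_{a i}` given by the images of the generators. -/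
def sumDesc {N : PersMod K n} (y : ∀ i, N.obj (a i)) : (⨁ fun i => free K (a i)) ⟶ N :=
  biproduct.desc fun i => freeDesc (y i)

@[simp] lemma sumDesc_sumGen {N : PersMod K n} (y : ∀ i, N.obj (a i)) (i : Fin p) :
    ap (sumDesc a y) _ (sumGen a i) = y i := by
  have : ap (sumDesc a y) _ (sumGen a i) =
    ap (biproduct.ι _ i ≫ biproduct.desc fun i => freeDesc (y i)) _ (freeGen (a i)) := rfl
  rw [this, biproduct.ι_desc, freeDesc_freeGen]

end Biproduct

/-- The module with a given presentation is the cokernel of the corresponding morphism of free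
modules. -/
def Presentation.isoCokernel {p q : ℕ} (D : Presentation K n (Fin p) (Fin q))
    (f : (⨁ fun j => free K (D.rdeg j)) ⟶ (⨁ fun i => free K (D.deg i)))
    (hf : ∀ j, ap f _ (sumGen D.rdeg j) = comb _ (sumGen D.deg) (D.rdeg j) (D.rel j)) :
    D.toPersMod ≅ cokernel f where
  hom := D.desc (fun i => ap (cokernel.π f) _ (sumGen D.deg i)) fun j => by
    rw [← ap_comb, ← hf, ← ap_comp, cokernel.condition]
    rfl
  inv := cokernel.desc f (sumDesc D.deg D.gen) <| sum_hom_ext _ fun j => by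
    rw [ap_comp, hf, ap_comb]
    simp only [sumDesc_sumGen]
    exact D.comb_rel j
  hom_inv_id := D.hom_ext fun i => by
    rw [ap_comp, Presentation.desc_gen, ← ap_comp, cokernel.π_desc, sumDesc_sumGen, ap_id]
  inv_hom_id := by
    rw [← cancel_epi (cokernel.π f), cokernel.π_desc_assoc]
    refine sum_hom_ext _ fun i => ?_
    rw [ap_comp, sumDesc_sumGen, Presentation.desc_gen, Category.comp_id]

/-- The relations are the coordinate vectors of the images under `f` of the generators of the
source. -/
lemma IsFP.exists_presentation {M : PersMod K n} (hM : M.IsFP) :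
    ∃ (p q : ℕ) (D : Presentation K n (Fin p) (Fin q)), Nonempty (M ≅ D.toPersMod) := by
  obtain ⟨p, q, a, b, f, ⟨e⟩⟩ := hM
  choose v hv hv' using fun j => exists_comb_sumGen a (ap f _ (sumGen b j))
  let D : Presentation K n (Fin p) (Fin q) := ⟨a, b, v, hv⟩
  exact ⟨p, q, D, ⟨e ≪≫ (D.isoCokernel f fun j => (hv' j).symm).symm⟩⟩

/-- Transport of a presentation along bijections of the index sets. -/
def Presentation.reindex {ι κ ι' κ' : Type} (D : Presentation K n ι κ) (e : ι' ≃ ι) (e' : κ' ≃ κ) :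
    Presentation K n ι' κ' where
  deg := D.deg ∘ e
  rdeg := D.rdeg ∘ e'
  rel j := D.rel (e' j) ∘ e
  rel_mem j i hi := D.rel_mem (e' j) (e i) hi

lemma comb_reindex {ι ι' : Type} [Fintype ι] [Fintype ι'] (e : ι' ≃ ι) (N : PersMod K n)
    {a : ι → RPoset n} (x : ∀ i, N.obj (a i)) (s : RPoset n) (v : ι → K) :
    N.comb (a := a ∘ e) (fun i => x (e i)) s (v ∘ e) = N.comb x s v :=
  e.sum_comp fun i => v i • N.push (x i) s

lemma Presentation.isFP {ι κ : Type} [Fintype ι] [Finite κ] (D : Presentation K n ι κ) :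
    D.toPersMod.IsFP := by
  have := Fintype.ofFinite κ
  let e := (Fintype.equivFin ι).symm
  let e' := (Fintype.equivFin κ).symm
  let D' := D.reindex e e'
  let f : (⨁ fun j => free K (D'.rdeg j)) ⟶ (⨁ fun i => free K (D'.deg i)) :=
    sumDesc _ fun j => comb _ (sumGen D'.deg) (D'.rdeg j) (D'.rel j)
  refine ⟨_, _, D'.deg, D'.rdeg, f, ⟨?_ ≪≫ D'.isoCokernel f fun j => sumDesc_sumGen _ _ j⟩⟩
  -- The degrees `D'.deg (e.symm i)` and `D.deg i` are equal but not definitionally so; `push`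
  -- transports between them.
  let y (i : ι) : D'.toPersMod.obj (D.deg i) := D'.toPersMod.push (D'.gen (e.symm i)) _
  have hy (i) : y (e i) = D'.gen i := by
    simp only [y]
    rw [Equiv.symm_apply_apply]
    exact push_self _ _
  let F : D.toPersMod ⟶ D'.toPersMod := D.desc y fun j => by
    obtain ⟨j, rfl⟩ := e'.surjective j
    rw [← comb_reindex e]
    simp only [hy]
    exact D'.comb_rel j
  let G : D'.toPersMod ⟶ D.toPersMod := D'.desc (fun i => D.gen (e i)) fun j =>
    (comb_reindex e _ _ _ _).trans (D.comb_rel (e' j))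
  have hF (i) : ap F _ (D.gen (e i)) = D'.gen i := (D.desc_gen _ _ _).trans (hy i)
  have hG (i) : ap G _ (D'.gen i) = D.gen (e i) := D'.desc_gen _ _ _
  exact
    { hom := F
      inv := G
      hom_inv_id := D.hom_ext fun i => by
        obtain ⟨i, rfl⟩ := e.surjective i
        exact (congrArg (ap G _) (hF i)).trans (hG i)
      inv_hom_id := D'.hom_ext fun i => (congrArg (ap F _) (hG i)).trans (hF i) }

end PersMod

/-! ### Interleavings as families of linear maps, and the triangle inequality -/

namespace PersMod

variable {K : Type u} [Field K] {n : ℕ}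

/-- The components of a morphism into a shifted module. -/
def apShift {M N : PersMod K n} {r : ℝ} (f : M ⟶ shift r N) (s : RPoset n) :
    M.obj s →ₗ[K] N.obj (addDiag s r) := ap f s

lemma apShift_tr {M N : PersMod K n} {r : ℝ} (f : M ⟶ shift r N) {s t : RPoset n} (h : s ≤ t)
    (x : M.obj s) : apShift f t (M.tr h x) = N.tr (addDiag_mono r h) (apShift f s x) :=
  ap_tr f h x

lemma le_addDiag_addDiag (s : RPoset n) (ε : ℝ≥0) : s ≤ addDiag (addDiag s ε) ε :=
  (le_addDiag s ε).trans (le_addDiag (addDiag s ε) ε)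

lemma addDiag_addDiag (s : RPoset n) (a b : ℝ) : addDiag (addDiag s a) b = addDiag s (a + b) :=
  funext fun k => add_assoc (s k) a b

/-- Interleavings in terms of linear maps. -/
lemma interleaved_iff {ε : ℝ≥0} {M N : PersMod K n} : Interleaved ε M N ↔
    ∃ (f : ∀ s, M.obj s →ₗ[K] N.obj (addDiag s ε)) (g : ∀ s, N.obj s →ₗ[K] M.obj (addDiag s ε)),
      (∀ s t (h : s ≤ t) x, f t (M.tr h x) = N.tr (addDiag_mono ε h) (f s x)) ∧
      (∀ s t (h : s ≤ t) x, g t (N.tr h x) = M.tr (addDiag_mono ε h) (g s x)) ∧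
      (∀ s x, g _ (f s x) = M.tr (le_addDiag_addDiag s ε) x) ∧
      (∀ s x, f _ (g s x) = N.tr (le_addDiag_addDiag s ε) x) := by
  constructor
  · rintro ⟨f, g, h1, h2⟩
    exact ⟨apShift f, apShift g, fun _ _ => apShift_tr f, fun _ _ => apShift_tr g,
      (isTriangle_iff f g).1 h1, (isTriangle_iff g f).1 h2⟩
  · rintro ⟨f, g, hf, hg, h1, h2⟩
    exact ⟨homMk f hf, homMk g hg, (isTriangle_iff _ _).2 h1, (isTriangle_iff _ _).2 h2⟩

lemma Interleaved.refl (M : PersMod K n) : Interleaved 0 M M := by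
  refine interleaved_iff.2 ⟨fun s => M.tr (le_addDiag s 0), fun s => M.tr (le_addDiag s 0),
    ?_, ?_, ?_, ?_⟩ <;> intros <;> simp only [tr_tr]

lemma Interleaved.trans {ε δ : ℝ≥0} {M N P : PersMod K n} (h : Interleaved ε M N)
    (h' : Interleaved δ N P) : Interleaved (ε + δ) M P := by
  obtain ⟨f, g, hf, hg, h1, h2⟩ := interleaved_iff.1 h
  obtain ⟨f', g', hf', hg', h1', h2'⟩ := interleaved_iff.1 h'
  -- Iterated shifts agree only propositionally, so the composites are corrected by structure
  -- morphisms between equal degrees.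
  have e (s : RPoset n) : addDiag (addDiag s ε) δ ≤ addDiag s (ε + δ : ℝ≥0) :=
    (addDiag_addDiag s ε δ).le
  have e' (s : RPoset n) : addDiag (addDiag s δ) ε ≤ addDiag s (ε + δ : ℝ≥0) :=
    ((addDiag_addDiag s δ ε).trans (by rw [add_comm, NNReal.coe_add])).le
  refine interleaved_iff.2 ⟨fun s => P.tr (e s) ∘ₗ f' _ ∘ₗ f s,
    fun s => M.tr (e' s) ∘ₗ g _ ∘ₗ g' s, ?_, ?_, ?_, ?_⟩
  · intro s t h x
    simp only [LinearMap.comp_apply, tr_tr, hf, hf']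
  · intro s t h x
    simp only [LinearMap.comp_apply, tr_tr, hg, hg']
  · intro s x
    simp only [LinearMap.comp_apply, tr_tr, hg, hg', h1, h1']
  · intro s x
    simp only [LinearMap.comp_apply, tr_tr, hf, hf', h2, h2']

lemma dI_lt_iff {M N : PersMod K n} {r : ℝ≥0∞} :
    dI M N < r ↔ ∃ ε : ℝ≥0, Interleaved ε M N ∧ (ε : ℝ≥0∞) < r := by
  simp [dI, iInf_lt_iff]

lemma dI_self (M : PersMod K n) : dI M M = 0 :=
  nonpos_iff_eq_zero.1 (iInf₂_le (0 : ℝ≥0) (Interleaved.refl M))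

lemma dI_triangle (M N P : PersMod K n) : dI M P ≤ dI M N + dI N P := by
  by_cases hN : dI M N = ⊤
  · simp [hN]
  by_cases hN' : dI N P = ⊤
  · simp [hN']
  refine ENNReal.le_of_forall_pos_le_add fun η hη _ => ?_
  have hη2 : ((η / 2 : ℝ≥0) : ℝ≥0∞) ≠ 0 := by simpa using hη.ne'
  obtain ⟨a, ha, ha'⟩ := dI_lt_iff.1 (ENNReal.lt_add_right hN hη2)
  obtain ⟨b, hb, hb'⟩ := dI_lt_iff.1 (ENNReal.lt_add_right hN' hη2)
  calc dI M P ≤ ((a + b : ℝ≥0) : ℝ≥0∞) := iInf₂_le (a + b) (ha.trans hb)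
    _ = a + b := by simp
    _ ≤ (dI M N + (η / 2 : ℝ≥0)) + (dI N P + (η / 2 : ℝ≥0)) := add_le_add ha'.le hb'.le
    _ = dI M N + dI N P + ((η / 2 + η / 2 : ℝ≥0) : ℝ≥0∞) := by push_cast; ring
    _ = _ := by rw [add_halves]

end PersMod

/-! ### The topology of the interleaving distance -/

namespace FPSpace

variable {K : Type u} [Field K] {n : ℕ}

lemma exists_rep (x : FPSpace K n) : ∃ (M : PersMod K n) (hM : M.IsFP), mk M hM = x := by
  obtain ⟨⟨M, hM⟩, rfl⟩ := Quotient.exists_rep x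
  exact ⟨M, hM, rfl⟩

lemma dist_self (x : FPSpace K n) : dist x x = 0 := by
  obtain ⟨M, hM, rfl⟩ := x.exists_rep
  exact M.dI_self

lemma dist_triangle (x y z : FPSpace K n) : dist x z ≤ dist x y + dist y z := by
  obtain ⟨M, hM, rfl⟩ := x.exists_rep
  obtain ⟨N, hN, rfl⟩ := y.exists_rep
  obtain ⟨P, hP, rfl⟩ := z.exists_rep
  exact M.dI_triangle N P

lemma isOpen_ball (x : FPSpace K n) {r : ℝ≥0} (hr : 0 < r) : IsOpen {y | dist x y < r} :=
  TopologicalSpace.isOpen_generateFrom_of_mem ⟨x, r, hr, rfl⟩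

/-- By definition the balls are only a subbasis; the triangle inequality makes the balls centred at
`x` a neighbourhood basis of `x`. -/
lemma exists_ball_subset {U : Set (FPSpace K n)} (hU : IsOpen U) :
    ∀ x ∈ U, ∃ r : ℝ≥0, 0 < r ∧ {y | dist x y < r} ⊆ U := by
  induction hU with
  | basic s hs =>
    obtain ⟨z, r, hr, rfl⟩ := hs
    intro x hx
    obtain ⟨δ, hδ, h⟩ := ENNReal.lt_iff_exists_add_pos_lt.1 (show dist z x < r from hx)
    refine ⟨δ, hδ, fun y hy => ?_⟩
    exact ((dist_triangle z x y).trans (add_le_add_right (le_of_lt hy) _)).trans_lt h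
  | univ => exact fun x _ => ⟨1, one_pos, Set.subset_univ _⟩
  | inter s t _ _ hs ht =>
    intro x hx
    obtain ⟨r, hr, h⟩ := hs x hx.1
    obtain ⟨r', hr', h'⟩ := ht x hx.2
    refine ⟨min r r', lt_min hr hr', fun y hy => ⟨h ?_, h' ?_⟩⟩
    · exact lt_of_lt_of_le hy (ENNReal.coe_le_coe.2 (min_le_left _ _))
    · exact lt_of_lt_of_le hy (ENNReal.coe_le_coe.2 (min_le_right _ _))
  | sUnion S _ ih =>
    rintro x ⟨s, hs, hx⟩
    obtain ⟨r, hr, h⟩ := ih s hs x hx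
    exact ⟨r, hr, h.trans (Set.subset_sUnion_of_mem hs)⟩

lemma mem_closure_iff {A : Set (FPSpace K n)} {x : FPSpace K n} :
    x ∈ closure A ↔ ∀ r : ℝ≥0, 0 < r → ∃ y ∈ A, dist x y < r := by
  rw [_root_.mem_closure_iff]
  constructor
  · intro h r hr
    obtain ⟨y, hy, hy'⟩ := h _ (isOpen_ball x hr) (by simpa [dist_self] using hr)
    exact ⟨y, hy', hy⟩
  · intro h U hU hx
    obtain ⟨r, hr, hrU⟩ := exists_ball_subset hU x hx
    obtain ⟨y, hy, hy'⟩ := h r hr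
    exact ⟨y, hrU hy', hy⟩

end FPSpace

/-! ### Robustness of modules with trivial idempotents -/

namespace PersMod

variable {K : Type u} [Field K] {n : ℕ}

/-- For a finite family of degrees, small diagonal translations create no new comparabilities. -/
lemma exists_pos_le_of_le_addDiag {ι : Type} [Finite ι] (d : ι → RPoset n) :
    ∃ γ : ℝ≥0, 0 < γ ∧ ∀ r : ℝ, r ≤ γ → ∀ i j, d i ≤ addDiag (d j) r → d i ≤ d j := by
  have h (i j : ι) : ∀ᶠ r : ℝ in nhdsWithin 0 (Set.Ioi 0), d i ≤ addDiag (d j) r → d i ≤ d j := by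
    by_cases hij : d i ≤ d j
    · simp [hij]
    obtain ⟨k, hk⟩ : ∃ k, d j k < d i k := by
      by_contra! h
      exact hij h
    filter_upwards [nhdsWithin_le_nhds (Iio_mem_nhds (sub_pos.2 hk))] with r hr hle
    have h1 : d i k ≤ d j k + r := hle k
    have h2 : r < d i k - d j k := hr
    linarith
  have h' := (Filter.eventually_all.2 fun i => Filter.eventually_all.2 (h i)).and
    self_mem_nhdsWithin
  obtain ⟨γ, hγ, hpos⟩ := h'.exists
  refine ⟨⟨γ, le_of_lt hpos⟩, hpos, fun r hr i j hij => hγ i j (le_trans hij fun k => ?_)⟩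
  exact add_le_add_right hr (d j k)

lemma exists_proj_incl {k : ℕ} (X : Fin k → PersMod K n) :
    ∃ (p : ∀ l, ⨁ X ⟶ X l) (q : ∀ l, X l ⟶ ⨁ X),
      (∀ l s x, ap (p l) s (ap (q l) s x) = x) ∧
      ∀ s x, ∑ l, ap (q l) s (ap (p l) s x) = x := by
  refine ⟨biproduct.π X, biproduct.ι X, fun l s x => ?_, fun s x => ?_⟩
  · rw [← ap_comp, biproduct.ι_π_self, ap_id]
  · have : ap (∑ l, biproduct.π X l ≫ biproduct.ι X l) s x = x := by
      rw [biproduct.total]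
      rfl
    rw [ap_sum, LinearMap.sum_apply] at this
    exact this

namespace Presentation

variable {ι κ : Type} [Fintype ι] (D : Presentation K n ι κ)

/-- The structure morphism `M(s) → M(t)` is bijective if there are no generators and relations
between the degrees `s` and `t`. -/
lemma tr_bijective {s t : RPoset n} (h : s ≤ t) (hg : ∀ i, D.deg i ≤ t → D.deg i ≤ s)
    (hr : ∀ j, D.rdeg j ≤ t → D.rdeg j ≤ s) : Function.Bijective (D.toPersMod.tr h) := by
  constructor
  · rw [← LinearMap.ker_eq_bot, LinearMap.ker_eq_bot']
    intro x hx
    obtain ⟨v, rfl⟩ := D.cls_surjective s x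
    rw [tr_cls, cls_eq_zero_iff] at hx
    rw [cls_eq_zero_iff]
    exact D.rels_le (fun j hj => D.rel_mem_rels (hr j hj)) hx
  · intro x
    obtain ⟨v, rfl⟩ := D.cls_surjective t x
    exact ⟨D.cls s ⟨v, fun i hi => hg i (v.2 i hi)⟩, rfl⟩

/-- A morphism `M ⟶ M[ε][ε]` lifts to an endomorphism of `M` if no generators and relations lie
between the degrees of the presentation and their translates. -/
lemma exists_lift {ε : ℝ≥0}
    (ψ : ∀ s, D.toPersMod.obj s →ₗ[K] D.toPersMod.obj (addDiag (addDiag s ε) ε))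
    (hψ : ∀ s t (h : s ≤ t) x, ψ t (D.toPersMod.tr h x) =
      D.toPersMod.tr (addDiag_mono ε (addDiag_mono ε h)) (ψ s x))
    (hg : ∀ i, Function.Bijective (D.toPersMod.tr (le_addDiag_addDiag (D.deg i) ε)))
    (hr : ∀ j, Function.Bijective (D.toPersMod.tr (le_addDiag_addDiag (D.rdeg j) ε))) :
    ∃ φ : D.toPersMod ⟶ D.toPersMod, ∀ s x,
      D.toPersMod.tr (le_addDiag_addDiag s ε) (ap φ s x) = ψ s x := by
  -- The generators are sent to the preimages of their images under `ψ`. Surjectivity at the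
  -- generator degrees provides these; injectivity at the relation degrees shows that they satisfy
  -- the relations.
  let Ψ : D.toPersMod ⟶ shift ε (shift ε D.toPersMod) := homMk ψ hψ
  let η : D.toPersMod ⟶ shift ε (shift ε D.toPersMod) :=
    homMk (fun s => D.toPersMod.tr (le_addDiag_addDiag s ε)) fun s t h x => by
      simp only [tr_shift, tr_tr]
  choose m hm using fun i => (hg i).2 (ap Ψ _ (D.gen i))
  have hm' (i) : ap η _ (m i) = ap Ψ _ (D.gen i) := hm i
  let φ : D.toPersMod ⟶ D.toPersMod := D.desc m fun j => by
    apply (hr j).1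
    change ap η _ _ = ap η _ 0
    rw [ap_comb]
    simp only [hm']
    rw [← ap_comb, comb_rel, map_zero, map_zero]
  have : φ ≫ η = Ψ := D.hom_ext fun i => by rw [ap_comp, desc_gen, hm']
  exact ⟨φ, fun s x => congrArg (fun f => ap f s x) this⟩

/-- If the only idempotent endomorphisms of `M` are `0 ≠ 1`, and `N` is sufficiently close to `M`,
then `M` is close to one of the summands in any direct sum decomposition of `N`. -/
theorem exists_interleaved_summand [Finite κ]
    (hid : ∀ φ : D.toPersMod ⟶ D.toPersMod, φ ≫ φ = φ → φ = 0 ∨ φ = 𝟙 _)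
    (h0 : 𝟙 D.toPersMod ≠ 0) :
    ∃ γ : ℝ≥0, 0 < γ ∧ ∀ (ε : ℝ≥0), ε ≤ γ → ∀ (N : PersMod K n) (k : ℕ)
      (X : Fin k → PersMod K n), Nonempty (N ≅ ⨁ X) → Interleaved ε D.toPersMod N →
      ∃ i, Interleaved ε D.toPersMod (X i) := by
  obtain ⟨γ, hγ, hd⟩ := exists_pos_le_of_le_addDiag (Sum.elim D.deg D.rdeg)
  -- Composing two maps `ψ l` shifts by `4ε`, which has to stay below the gap `γ`.
  refine ⟨γ / 4, by positivity, fun ε hε N k X ⟨e⟩ hMN => ?_⟩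
  obtain ⟨f, g, hf, hg, h1, h2⟩ := interleaved_iff.1 (hMN.congr (Iso.refl _) e)
  have hε4 : (ε : ℝ) ≤ γ / 4 := by exact_mod_cast hε
  have hε0 : (0 : ℝ) ≤ ε := ε.coe_nonneg
  have hbij (i : ι ⊕ κ) {r : ℝ} (hr : r ≤ γ) {t : RPoset n}
      (ht : t = addDiag (Sum.elim D.deg D.rdeg i) r) (h : Sum.elim D.deg D.rdeg i ≤ t) :
      Function.Bijective (D.toPersMod.tr h) := by
    subst ht
    exact D.tr_bijective h (fun i' => hd r hr (.inl i') i) (fun j => hd r hr (.inr j) i)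
  have hg2 (i) : Function.Bijective (D.toPersMod.tr (le_addDiag_addDiag (D.deg i) ε)) :=
    hbij (.inl i) (by linarith) (addDiag_addDiag _ _ _) _
  have hr2 (j) : Function.Bijective (D.toPersMod.tr (le_addDiag_addDiag (D.rdeg j) ε)) :=
    hbij (.inr j) (by linarith) (addDiag_addDiag _ _ _) _
  have hg4 (i) : Function.Bijective (D.toPersMod.tr
      ((le_addDiag_addDiag (D.deg i) ε).trans (le_addDiag_addDiag _ ε))) :=
    hbij (.inl i) (r := ε + ε + ε + ε) (by linarith) (by simp only [addDiag_addDiag]; rfl) _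
  obtain ⟨p, q, hqp, hsum⟩ := exists_proj_incl X
  obtain ⟨ψ, hψ⟩ : ∃ ψ : ∀ (l : Fin k) (s), D.toPersMod.obj s →ₗ[K]
      D.toPersMod.obj (addDiag (addDiag s ε) ε),
      ∀ l s x, ψ l s x = g _ (ap (q l) _ (ap (p l) _ (f s x))) :=
    ⟨fun l s => g _ ∘ₗ ap (q l) _ ∘ₗ ap (p l) _ ∘ₗ f s, fun _ _ _ => rfl⟩
  have hψtr (l s t) (h : s ≤ t) (x) : ψ l t (D.toPersMod.tr h x) =
      D.toPersMod.tr (addDiag_mono ε (addDiag_mono ε h)) (ψ l s x) := by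
    simp only [hψ, hf, ap_tr, hg]
  have hφ (l) : ∃ φ : D.toPersMod ⟶ D.toPersMod, ∀ s x,
      D.toPersMod.tr (le_addDiag_addDiag s ε) (ap φ s x) = ψ l s x :=
    D.exists_lift (ψ l) (hψtr l) hg2 hr2
  choose φ hφ using hφ
  -- Idempotence up to shift: the inner `f ∘ g` is a structure morphism, and `p l ∘ q l` is the
  -- identity.
  have hψψ (l s x) : ψ l _ (ψ l s x) = D.toPersMod.tr (le_addDiag_addDiag _ ε) (ψ l s x) := by
    simp only [hψ, h2, ap_tr, hqp, hg]
  have hidem (l) : φ l ≫ φ l = φ l := D.hom_ext fun i => by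
    apply (hg4 i).1
    rw [ap_comp, ← tr_tr _ (le_addDiag_addDiag (D.deg i) ε) (le_addDiag_addDiag _ ε), hφ,
      ← tr_tr _ (le_addDiag_addDiag (D.deg i) ε) (le_addDiag_addDiag _ ε), hφ,
      ← hψψ l _ (D.gen i), ← hφ l _ (D.gen i), hψtr]
  -- If every `φ l` vanished, the sum `g ∘ f` of the `ψ l` would vanish on the generators; it is a
  -- structure morphism, injective in their degrees.
  obtain ⟨l, hl⟩ : ∃ l, φ l ≠ 0 := by
    by_contra! hall
    apply h0
    have hz (i l) : g _ (ap (q l) _ (ap (p l) _ (f _ (D.gen i)))) = 0 := by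
      rw [← hψ, ← hφ, hall l, ap_zero, LinearMap.zero_apply, map_zero]
    have hgen (i) : D.gen i = 0 := (hg2 i).1 <| by
      rw [← h1, ← hsum _ (f _ (D.gen i)), map_sum, map_zero]
      exact Finset.sum_eq_zero fun l _ => hz i l
    exact D.hom_ext fun i => hgen i
  have hone : φ l = 𝟙 _ := (hid _ (hidem l)).resolve_left hl
  have h2' (s) (x : (X l).obj s) : ap (p l) _ (f _ (g s (ap (q l) s x))) =
      (X l).tr (le_addDiag_addDiag s ε) x := by
    rw [h2, ap_tr, hqp]
  have h1' (s) (x : D.toPersMod.obj s) : g _ (ap (q l) _ (ap (p l) _ (f s x))) =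
      D.toPersMod.tr (le_addDiag_addDiag s ε) x := by
    rw [← hψ, ← hφ, hone, ap_id]
  refine ⟨l, interleaved_iff.2 ⟨fun s => ap (p l) _ ∘ₗ f s, fun s => g s ∘ₗ ap (q l) s,
    ?_, ?_, h1', h2'⟩⟩
  · intro s t h x
    simp only [LinearMap.comp_apply, hf, ap_tr]
  · intro s t h x
    simp only [LinearMap.comp_apply, hg, ap_tr]

end Presentation

end PersMod

/-! ### Matrices of interleavings and endomorphisms -/

namespace PersMod

variable {K : Type u} [Field K] {n : ℕ} {ι κ ι' κ' : Type} [Fintype ι]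

lemma push_comb (N : PersMod K n) {a : ι → RPoset n} (x : ∀ i, N.obj (a i)) {s t : RPoset n}
    (h : s ≤ t) {v : ι → K} (hv : v ∈ below K a s) :
    N.push (N.comb x s v) t = N.comb x t v := by
  rw [push_of_le _ h, tr_comb _ _ _ hv]

/-- The support conditions are essential: `push` is `0` when the degrees are not comparable, so it
is compatible with composition only along actual inequalities. -/
lemma comb_comb [Fintype ι'] (N : PersMod K n) {a : ι → RPoset n} (x : ∀ i, N.obj (a i))
    {b : ι' → RPoset n} {w : ι' → ι → K} (hw : ∀ u, w u ∈ below K a (b u))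
    {t : RPoset n} {v : ι' → K}
    (hv : v ∈ below K b t) :
    N.comb (fun u => N.comb x (b u) (w u)) t v = N.comb x t (∑ u, v u • w u) := by
  rw [comb_apply, map_sum]
  refine Finset.sum_congr rfl fun u _ => ?_
  by_cases h : v u = 0
  · simp [h]
  · rw [push_comb N x (hv u h) (hw u), map_smul]

lemma addDiag_le_addDiag_iff {s t : RPoset n} {r : ℝ} : addDiag s r ≤ addDiag t r ↔ s ≤ t :=
  ⟨fun h k => le_of_add_le_add_right (h k), fun h => addDiag_mono r h⟩

lemma push_shift (N : PersMod K n) (r : ℝ) {a : RPoset n} (x : N.obj (addDiag a r)) (s : RPoset n) :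
    (shift r N).push (a := a) x s = N.push (a := addDiag a r) x (addDiag s r) := by
  by_cases h : a ≤ s
  · rw [push_of_le _ h, push_of_le _ (addDiag_mono r h), tr_shift]
  · rw [push, push, dif_neg h, dif_neg (mt addDiag_le_addDiag_iff.1 h)]

namespace Presentation

variable (D : Presentation K n ι κ) (D' : Presentation K n ι' κ')

/-- The morphism `M ⟶ N[r]` determined by images of the generators that satisfy the relations. -/
lemma exists_apShift {N : PersMod K n} {r : ℝ} (x : ∀ i, N.obj (addDiag (D.deg i) r))
    (hx : ∀ j, N.comb (a := fun i => addDiag (D.deg i) r) x (addDiag (D.rdeg j) r) (D.rel j) = 0) :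
    ∃ f : ∀ s, D.toPersMod.obj s →ₗ[K] N.obj (addDiag s r),
      (∀ s t (h : s ≤ t) y, f t (D.toPersMod.tr h y) = N.tr (addDiag_mono r h) (f s y)) ∧
      ∀ s v, f s (D.toPersMod.comb D.gen s v) =
        N.comb (a := fun i => addDiag (D.deg i) r) x (addDiag s r) v := by
  have hc (s : RPoset n) (v : ι → K) : comb (shift r N) (a := D.deg) x s v =
      N.comb (a := fun i => addDiag (D.deg i) r) x (addDiag s r) v := by
    simp only [comb_apply]
    exact Finset.sum_congr rfl fun i _ => congrArg (v i • ·) (push_shift N r (x i) s)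
  let F : D.toPersMod ⟶ shift r N := D.desc x fun j => (hc _ _).trans (hx j)
  have hF : (fun i => ap F _ (D.gen i)) = x := funext fun i => D.desc_gen _ _ i
  refine ⟨apShift F, fun s t h => apShift_tr F h, fun s v => (ap_comb F D.gen s v).trans ?_⟩
  rw [hF]
  exact hc s v

lemma sum_smul_mem_below {a : ι' → RPoset n} {b : ι → RPoset n} {s : RPoset n} {r : ℝ}
    {A : ι → ι' → K} (hA : ∀ i, A i ∈ below K a (addDiag (b i) r)) {v : ι → K}
    (hv : v ∈ below K b s) : ∑ i, v i • A i ∈ below K a (addDiag s r) := by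
  refine Submodule.sum_mem _ fun i _ => ?_
  by_cases h : v i = 0
  · simp [h]
  · exact Submodule.smul_mem _ _ (below_mono _ (addDiag_mono r (hv i h)) (hA i))

lemma exists_apShift_of_matrix [Fintype ι'] {r : ℝ} (A : ι → ι' → K)
    (hA : ∀ i, A i ∈ below K D'.deg (addDiag (D.deg i) r))
    (hAr : ∀ j, ∑ i, D.rel j i • A i ∈ D'.rels (addDiag (D.rdeg j) r)) :
    ∃ f : ∀ s, D.toPersMod.obj s →ₗ[K] D'.toPersMod.obj (addDiag s r),
      (∀ s t (h : s ≤ t) y, f t (D.toPersMod.tr h y) = D'.toPersMod.tr (addDiag_mono r h) (f s y)) ∧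
      ∀ s, ∀ v ∈ below K D.deg s, f s (D.toPersMod.comb D.gen s v) =
        D'.toPersMod.comb D'.gen (addDiag s r) (∑ i, v i • A i) := by
  have key {s} {v : ι → K} (hv : v ∈ below K D.deg s) :
      D'.toPersMod.comb (fun i => D'.toPersMod.comb D'.gen (addDiag (D.deg i) r) (A i))
        (addDiag s r) v = D'.toPersMod.comb D'.gen (addDiag s r) (∑ i, v i • A i) :=
    comb_comb (b := fun i => addDiag (D.deg i) r) _ _ hA fun i hi => addDiag_mono r (hv i hi)
  obtain ⟨f, hf, hf'⟩ := D.exists_apShift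
    (fun i => D'.toPersMod.comb D'.gen (addDiag (D.deg i) r) (A i)) fun j => by
      rw [key (D.rel_mem j)]
      exact D'.comb_eq_zero_of_mem_rels D'.gen D'.comb_rel (hAr j)
  exact ⟨f, hf, fun s v hv => (hf' s v).trans (key hv)⟩

lemma sum_smul_sub_mem_rels [DecidableEq ι] {r : ℝ} {C : ι → ι → K}
    (hC : ∀ i, C i - Pi.single i 1 ∈ D.rels (addDiag (D.deg i) r)) {s : RPoset n} {v : ι → K}
    (hv : v ∈ below K D.deg s) : ∑ i, v i • C i - v ∈ D.rels (addDiag s r) := by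
  have h : ∑ i, v i • C i - v = ∑ i, v i • (C i - Pi.single i 1) := by
    simp only [smul_sub, Finset.sum_sub_distrib, sub_right_inj]
    exact pi_eq_sum_univ' v
  rw [h]
  refine Submodule.sum_mem _ fun i _ => ?_
  by_cases h : v i = 0
  · simp [h]
  · exact Submodule.smul_mem _ _ (D.rels_mono (addDiag_mono r (hv i h)) (hC i))

lemma comb_gen_eq_of_sub_mem {s : RPoset n} {v w : ι → K} (h : v - w ∈ D.rels s) :
    D.toPersMod.comb D.gen s v = D.toPersMod.comb D.gen s w :=
  sub_eq_zero.1 <| (map_sub _ v w).symm.trans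
    (D.comb_eq_zero_of_mem_rels D.gen D.comb_rel h)

/-- An interleaving given by two matrices. -/
theorem interleaved_of_matrices [Fintype ι'] [DecidableEq ι] [DecidableEq ι'] {ε : ℝ≥0}
    (A : ι → ι' → K) (B : ι' → ι → K)
    (hA : ∀ i, A i ∈ below K D'.deg (addDiag (D.deg i) ε))
    (hB : ∀ i, B i ∈ below K D.deg (addDiag (D'.deg i) ε))
    (hAr : ∀ j, ∑ i, D.rel j i • A i ∈ D'.rels (addDiag (D.rdeg j) ε))
    (hBr : ∀ j, ∑ i, D'.rel j i • B i ∈ D.rels (addDiag (D'.rdeg j) ε))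
    (hAB : ∀ i, ∑ u, A i u • B u - Pi.single i 1 ∈ D.rels (addDiag (D.deg i) (ε + ε)))
    (hBA : ∀ u, ∑ i, B u i • A i - Pi.single u 1 ∈ D'.rels (addDiag (D'.deg u) (ε + ε))) :
    Interleaved ε D.toPersMod D'.toPersMod := by
  have assoc {α β γ : Type} [Fintype α] [Fintype β] (v : α → K) (P : α → β → K) (Q : β → γ → K) :
      ∑ u, (∑ i, v i • P i) u • Q u = ∑ i, v i • ∑ u, P i u • Q u := by
    simp only [Finset.sum_apply, Pi.smul_apply, Finset.sum_smul, Finset.smul_sum, smul_assoc]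
    exact Finset.sum_comm
  obtain ⟨f, hf, hf'⟩ := D.exists_apShift_of_matrix D' A hA hAr
  obtain ⟨g, hg, hg'⟩ := D'.exists_apShift_of_matrix D B hB hBr
  refine interleaved_iff.2 ⟨f, g, hf, hg, fun s x => ?_, fun s x => ?_⟩
  · obtain ⟨v, hv, rfl⟩ := D.comb_gen_surjective x
    rw [hf' s v hv, hg' _ _ (sum_smul_mem_below hA hv), tr_comb _ _ _ hv]
    refine D.comb_gen_eq_of_sub_mem ?_
    rw [addDiag_addDiag, assoc]
    exact D.sum_smul_sub_mem_rels hAB hv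
  · obtain ⟨v, hv, rfl⟩ := D'.comb_gen_surjective x
    rw [hg' s v hv, hf' _ _ (sum_smul_mem_below hB hv), tr_comb _ _ _ hv]
    refine D'.comb_gen_eq_of_sub_mem ?_
    rw [addDiag_addDiag, assoc]
    exact D'.sum_smul_sub_mem_rels hBA hv

/-- `φ` is given on generators by the matrix `Φ`. -/
def IsMatrix (φ : D.toPersMod ⟶ D.toPersMod) (Φ : ι → ι → K) : Prop :=
  ∀ i, Φ i ∈ below K D.deg (D.deg i) ∧
    ap φ _ (D.gen i) = D.toPersMod.comb D.gen (D.deg i) (Φ i)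

lemma exists_isMatrix (φ : D.toPersMod ⟶ D.toPersMod) : ∃ Φ, D.IsMatrix φ Φ := by
  choose Φ hΦ hΦ' using fun i => D.comb_gen_surjective (ap φ _ (D.gen i))
  exact ⟨Φ, fun i => ⟨hΦ i, (hΦ' i).symm⟩⟩

variable {D}

lemma IsMatrix.ap_comb {φ : D.toPersMod ⟶ D.toPersMod} {Φ : ι → ι → K} (h : D.IsMatrix φ Φ)
    {s : RPoset n} {v : ι → K} (hv : v ∈ below K D.deg s) :
    ap φ s (D.toPersMod.comb D.gen s v) = D.toPersMod.comb D.gen s (∑ i, v i • Φ i) := by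
  rw [PersMod.ap_comb, ← comb_comb _ _ (fun i => (h i).1) hv]
  simp only [(h _).2]

lemma IsMatrix.sum_mem_below {φ : D.toPersMod ⟶ D.toPersMod} {Φ : ι → ι → K}
    (h : D.IsMatrix φ Φ) {s : RPoset n} {v : ι → K} (hv : v ∈ below K D.deg s) :
    ∑ i, v i • Φ i ∈ below K D.deg s := by
  refine Submodule.sum_mem _ fun i _ => ?_
  by_cases h' : v i = 0
  · simp [h']
  · exact Submodule.smul_mem _ _ (below_mono _ (hv i h') (h i).1)

/-- A matrix represents a morphism only modulo relations, and this is the constraint that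
well-definedness puts on it; `tack_diag` exploits it. -/
lemma IsMatrix.sum_rel_mem {φ : D.toPersMod ⟶ D.toPersMod} {Φ : ι → ι → K}
    (h : D.IsMatrix φ Φ) (j : κ) : ∑ i, D.rel j i • Φ i ∈ D.rels (D.rdeg j) := by
  rw [← D.comb_gen_eq_zero_iff (h.sum_mem_below (D.rel_mem j)), ← h.ap_comb (D.rel_mem j),
    D.comb_rel, map_zero]

lemma gen_eq_comb [DecidableEq ι] (i : ι) :
    D.gen i = D.toPersMod.comb D.gen (D.deg i) (Pi.single i 1) := by
  simp

lemma IsMatrix.one_sub [DecidableEq ι] {φ : D.toPersMod ⟶ D.toPersMod} {Φ : ι → ι → K}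
    (h : D.IsMatrix φ Φ) : D.IsMatrix (𝟙 _ - φ) (fun i => Pi.single i 1 - Φ i) := fun i =>
  ⟨Submodule.sub_mem _ (single_mem_below _ le_rfl _) (h i).1, by
    rw [map_sub, ← gen_eq_comb, ← (h i).2]
    rfl⟩

/-- If the degrees of the generators are distinct, an idempotent endomorphism whose matrix has
zero diagonal vanishes. -/
lemma IsMatrix.eq_zero (hdeg : Function.Injective D.deg) {φ : D.toPersMod ⟶ D.toPersMod}
    {Φ : ι → ι → K} (h : D.IsMatrix φ Φ) (hφ : φ ≫ φ = φ) (h0 : ∀ i, Φ i i = 0) : φ = 0 := by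
  refine D.hom_ext ?_
  let r : ι → ι → Prop := fun i j => D.deg i < D.deg j
  have : IsTrans ι r := ⟨fun _ _ _ => lt_trans⟩
  have : Std.Irrefl r := ⟨fun _ => lt_irrefl _⟩
  intro i
  induction i using (Finite.wellFounded_of_trans_of_irrefl r).induction with
  | _ i ih =>
    have hi : ap φ _ (D.gen i) = ap φ _ (ap φ _ (D.gen i)) := by rw [← ap_comp, hφ]
    -- With zero diagonal and distinct degrees, `φ (gen i)` involves only generators of strictly
    -- smaller degree, which `φ` kills by induction.
    rw [hi, (h i).2, PersMod.ap_comb, comb_apply]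
    refine Finset.sum_eq_zero fun j _ => ?_
    by_cases hj : Φ i j = 0
    · simp [hj]
    have hij : D.deg j ≠ D.deg i := fun e => hj (by rw [hdeg e, h0])
    rw [ih j (lt_of_le_of_ne ((h i).1 j hj) hij)]
    simp [push]

/-- A criterion for the absence of non-trivial idempotent endomorphisms. -/
theorem eq_zero_or_eq_id_of_idempotent (hdeg : Function.Injective D.deg)
    (hdiag : ∀ Φ : ι → ι → K, (∀ i, Φ i ∈ below K D.deg (D.deg i)) →
      (∀ j, ∑ i, D.rel j i • Φ i ∈ D.rels (D.rdeg j)) → ∀ i j, Φ i i = Φ j j)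
    (i₀ : ι) (hi₀ : ∀ v ∈ D.rels (D.deg i₀), v i₀ = 0)
    (φ : D.toPersMod ⟶ D.toPersMod) (hφ : φ ≫ φ = φ) : φ = 0 ∨ φ = 𝟙 _ := by
  classical
  obtain ⟨Φ, h⟩ := D.exists_isMatrix φ
  have hd := hdiag Φ (fun i => (h i).1) h.sum_rel_mem
  -- Compare the `i₀`-coordinates of `Φ²` and `Φ`, which no relation in degree `deg i₀` affects. A
  -- non-zero off-diagonal term `Φ i₀ i * Φ i i₀` would force `deg i = deg i₀`.
  have hsq : Φ i₀ i₀ * Φ i₀ i₀ = Φ i₀ i₀ := by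
    have h1 : ∑ i, Φ i₀ i • Φ i - Φ i₀ ∈ D.rels (D.deg i₀) := by
      rw [← D.comb_gen_eq_zero_iff (Submodule.sub_mem _ (h.sum_mem_below (h i₀).1) (h i₀).1),
        map_sub, ← h.ap_comb (h i₀).1, ← (h i₀).2, ← ap_comp, hφ, sub_self]
    have h2 := hi₀ _ h1
    rw [Pi.sub_apply, Finset.sum_apply, sub_eq_zero, Finset.sum_eq_single i₀] at h2
    · simpa using h2
    · intro i _ hi
      by_contra hne
      rw [Pi.smul_apply, smul_eq_mul, mul_eq_zero, not_or] at hne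
      exact hi (hdeg (le_antisymm ((h i₀).1 i hne.1) ((h i).1 i₀ hne.2)))
    · simp
  rcases IsIdempotentElem.iff_eq_zero_or_one.1 hsq with h0 | h1
  · exact .inl (h.eq_zero hdeg hφ fun i => (hd i i₀).trans h0)
  -- When the diagonal is `1`, the complementary idempotent `𝟙 - φ` has zero diagonal.
  · refine .inr (sub_eq_zero.1 (h.one_sub.eq_zero hdeg ?_ fun i => ?_)).symm
    · simp [hφ]
    · simp [(hd i i₀).trans h1]

lemma id_ne_zero (i₀ : ι) (hi₀ : ∀ v ∈ D.rels (D.deg i₀), v i₀ = 0) : 𝟙 D.toPersMod ≠ 0 := by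
  classical
  intro h
  have h1 : D.gen i₀ = 0 := congrArg (fun φ => ap φ _ (D.gen i₀)) h
  rw [gen_eq_comb, D.comb_gen_eq_zero_iff (single_mem_below _ le_rfl _)] at h1
  simpa using hi₀ _ h1

end Presentation

end PersMod

/-! ### Tacking the generators together -/

namespace PersMod

variable {K : Type u} [Field K] {n : ℕ} {ι κ : Type}

/-- Degrees used to connect the generators of a presentation whose generators have degrees `a i`.
Each generator is replaced by two generators, of degrees `p i` and `q i`, that become equal in
degree `a i + ε`. There are further generators of degrees `k i`, which vanish in degree `k i + ε`.
The three generators with index `i` are connected by a relation in degree `c i`,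
and those of degrees `k i` are connected by a relation in degree `d`. -/
structure TackData (n : ℕ) {ι : Type} (a : ι → RPoset n) (ε : ℝ≥0) where
  p : ι → RPoset n
  q : ι → RPoset n
  k : ι → RPoset n
  c : ι → RPoset n
  d : RPoset n
  a_le_p : ∀ i, a i ≤ p i
  p_le : ∀ i, p i ≤ addDiag (a i) ε
  a_le_q : ∀ i, a i ≤ q i
  q_le : ∀ i, q i ≤ addDiag (a i) ε
  p_le_c : ∀ i, p i ≤ c i
  q_le_c : ∀ i, q i ≤ c i
  k_le_c : ∀ i, k i ≤ c i
  k_le_d : ∀ i, k i ≤ d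
  not_a_le_c : ∀ i, ¬ addDiag (a i) ε ≤ c i
  not_k_le_c : ∀ i, ¬ addDiag (k i) ε ≤ c i
  not_k_le_d : ∀ i, ¬ addDiag (k i) ε ≤ d
  not_d_le_c : ∀ i, ¬ d ≤ c i
  not_c_le_d : ∀ i, ¬ c i ≤ d
  not_p_le_q : ∀ i, ¬ p i ≤ q i
  not_q_le_p : ∀ i, ¬ q i ≤ p i
  not_p_le_k : ∀ i, ¬ p i ≤ k i
  not_q_le_k : ∀ i, ¬ q i ≤ k i
  not_k_le_p : ∀ i, ¬ k i ≤ p i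
  not_k_le_q : ∀ i, ¬ k i ≤ q i
  eq_of_k_le : ∀ i j, k i ≤ k j → i = j
  injective : Function.Injective (Sum.elim p (Sum.elim q k))

namespace Presentation

variable [DecidableEq ι] (D : Presentation K n ι κ) {ε : ℝ≥0} (T : TackData n D.deg ε)

/-- The relations of the presentation with connected generators. -/
def tackRel : κ ⊕ ι ⊕ ι ⊕ ι ⊕ Unit → ι ⊕ ι ⊕ ι → K :=
  Sum.elim (fun j => Sum.elim 0 (Sum.elim (D.rel j) 0)) <|
  Sum.elim (fun i => Sum.elim (-Pi.single i 1) (Sum.elim (Pi.single i 1) 0)) <|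
  Sum.elim (fun i => Sum.elim 0 (Sum.elim 0 (Pi.single i 1))) <|
  Sum.elim (fun i => Sum.elim (-Pi.single i 1) (Sum.elim (Pi.single i 1) (Pi.single i 1))) <|
  fun _ => Sum.elim 0 (Sum.elim 0 1)

/-- The presentation with connected generators. -/
def tack : Presentation K n (ι ⊕ ι ⊕ ι) (κ ⊕ ι ⊕ ι ⊕ ι ⊕ Unit) where
  deg := Sum.elim T.p (Sum.elim T.q T.k)
  rdeg := Sum.elim (fun j => addDiag (D.rdeg j) ε) <| Sum.elim (fun i => addDiag (D.deg i) ε) <|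
    Sum.elim (fun i => addDiag (T.k i) ε) <| Sum.elim T.c fun _ => T.d
  rel := D.tackRel
  rel_mem := by
    have h1 (i l : ι) (h : (Pi.single i 1 : ι → K) l ≠ 0) : l = i := by
      by_contra h'
      simp [h'] at h
    rintro (j | i | i | i | _) (l | l | l) hl <;>
      simp only [tackRel, Sum.elim_inl, Sum.elim_inr, Pi.zero_apply, ne_eq, not_true_eq_false,
        Pi.neg_apply, neg_eq_zero] at hl ⊢
    · exact (T.q_le l).trans (addDiag_mono ε (D.rel_mem j l hl))
    · exact h1 i l hl ▸ T.p_le l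
    · exact h1 i l hl ▸ T.q_le l
    · exact h1 i l hl ▸ le_addDiag (T.k l) ε
    · exact h1 i l hl ▸ T.p_le_c l
    · exact h1 i l hl ▸ T.q_le_c l
    · exact h1 i l hl ▸ T.k_le_c l
    · exact T.k_le_d l

/-- A linear functional vanishes on the relations in degree `s` if it vanishes on the defining
relations of degree at most `s`. -/
lemma eq_zero_of_mem_tack_rels (f : (ι ⊕ ι ⊕ ι → K) →ₗ[K] K) {s : RPoset n}
    (h : ∀ j, (D.tack T).rdeg j ≤ s → f (D.tackRel j) = 0) :
    ∀ v ∈ (D.tack T).rels s, f v = 0 := fun _ hv =>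
  (D.tack T).rels_le (V := LinearMap.ker f) h hv

/-- The relations involving `k i` live in degrees `k i + ε`, `c i` and `d`, none of which is below
`k i`. This makes `k i` a suitable `i₀` in the criterion for trivial idempotents. -/
lemma tack_rels_apply (i : ι) :
    ∀ v ∈ (D.tack T).rels ((D.tack T).deg (.inr (.inr i))), v (.inr (.inr i)) = 0 := by
  refine D.eq_zero_of_mem_tack_rels T (LinearMap.proj (.inr (.inr i))) ?_
  rintro (j | l | l | l | _) hj
  · simp [tackRel]
  · simp [tackRel]
  · have hl : i ≠ l := by
      rintro rfl
      exact T.not_k_le_c i (le_trans hj (T.k_le_c i))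
    simp [tackRel, hl]
  · have hl : i ≠ l := by
      rintro rfl
      exact T.not_p_le_k i ((T.p_le_c i).trans hj)
    simp [tackRel, hl]
  · exact absurd (le_trans hj (T.k_le_c i)) (T.not_d_le_c i)

variable [Fintype ι]

/-- In degree `c i`, the only relation touching the coordinates `p i`, `q i`, `k i` is `q i - p i +
k i`, so every relation there restricts to a multiple of `(-1, 1, 1)`. The three degrees are
pairwise incomparable, so the image of this relation restricts to its diagonal entries with the same
signs, and these must agree. In degree `d`, the only relation touching the `k`-coordinates is `∑ k
i`; the `k i` form an antichain, so their diagonal entries agree for all `i`. -/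
lemma tack_diag (Φ : ι ⊕ ι ⊕ ι → ι ⊕ ι ⊕ ι → K)
    (hΦ : ∀ i, Φ i ∈ below K (D.tack T).deg ((D.tack T).deg i))
    (hr : ∀ j, ∑ i, (D.tack T).rel j i • Φ i ∈ (D.tack T).rels ((D.tack T).rdeg j)) :
    ∀ i j, Φ i i = Φ j j := by
  have hne {u v} (h : ¬ (D.tack T).deg v ≤ (D.tack T).deg u) : Φ u v = 0 := by
    by_contra h'
    exact h (hΦ u v h')
  have hpq (i) : Φ (.inl i) (.inr (.inl i)) = 0 := hne (T.not_q_le_p i)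
  have hpk (i) : Φ (.inl i) (.inr (.inr i)) = 0 := hne (T.not_k_le_p i)
  have hqp (i) : Φ (.inr (.inl i)) (.inl i) = 0 := hne (T.not_p_le_q i)
  have hqk (i) : Φ (.inr (.inl i)) (.inr (.inr i)) = 0 := hne (T.not_k_le_q i)
  have hkp (i) : Φ (.inr (.inr i)) (.inl i) = 0 := hne (T.not_p_le_k i)
  have hkq (i) : Φ (.inr (.inr i)) (.inr (.inl i)) = 0 := hne (T.not_q_le_k i)
  have hkk (i j) (hij : i ≠ j) : Φ (.inr (.inr i)) (.inr (.inr j)) = 0 :=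
    hne fun h => hij (T.eq_of_k_le j i h).symm
  -- An original relation involving generator `i` has been moved above `a i + ε`, hence is not
  -- present in degree `c i`.
  have hold (i) (j) (h : addDiag (D.rdeg j) ε ≤ T.c i) : D.rel j i = 0 := by
    by_contra h'
    exact T.not_a_le_c i ((addDiag_mono ε (D.rel_mem j i h')).trans h)
  let e (u : ι ⊕ ι ⊕ ι) : (ι ⊕ ι ⊕ ι → K) →ₗ[K] K := LinearMap.proj u
  have h1 (i) : Φ (.inr (.inr i)) (.inr (.inr i)) = Φ (.inr (.inl i)) (.inr (.inl i)) := by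
    have := D.eq_zero_of_mem_tack_rels T (e (.inr (.inr i)) - e (.inr (.inl i))) (s := T.c i) ?_ _
      (hr (.inr (.inr (.inr (.inl i)))))
    · simp [e, tack, tackRel, Fintype.sum_sum_type, Pi.single_apply,
        hpq, hpk, hqk, hkq] at this
      linear_combination this
    · rintro (j | l | l | l | _) hj
      · simp [e, tackRel, hold i j hj]
      · have hl : i ≠ l := by rintro rfl; exact T.not_a_le_c i hj
        simp [e, tackRel, hl]
      · have hl : i ≠ l := by rintro rfl; exact T.not_k_le_c i hj
        simp [e, tackRel, hl]
      · simp [e, tackRel]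
      · exact absurd hj (T.not_d_le_c i)
  have h2 (i) : Φ (.inr (.inr i)) (.inr (.inr i)) = Φ (.inl i) (.inl i) := by
    have := D.eq_zero_of_mem_tack_rels T (e (.inr (.inr i)) + e (.inl i)) (s := T.c i) ?_ _
      (hr (.inr (.inr (.inr (.inl i)))))
    · simp [e, tack, tackRel, Fintype.sum_sum_type, Pi.single_apply,
        hpk, hqk, hkp, hqp] at this
      linear_combination this
    · rintro (j | l | l | l | _) hj
      · simp [e, tackRel]
      · have hl : i ≠ l := by rintro rfl; exact T.not_a_le_c i hj
        simp [e, tackRel, hl]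
      · have hl : i ≠ l := by rintro rfl; exact T.not_k_le_c i hj
        simp [e, tackRel, hl]
      · simp [e, tackRel]
      · exact absurd hj (T.not_d_le_c i)
  have h3 (i j) : Φ (.inr (.inr i)) (.inr (.inr i)) = Φ (.inr (.inr j)) (.inr (.inr j)) := by
    have := D.eq_zero_of_mem_tack_rels T (e (.inr (.inr i)) - e (.inr (.inr j))) (s := T.d) ?_ _
      (hr (.inr (.inr (.inr (.inr ())))))
    · have hsum (l : ι) : ∑ i, Φ (.inr (.inr i)) (.inr (.inr l)) =
          Φ (.inr (.inr l)) (.inr (.inr l)) :=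
        Finset.sum_eq_single l (fun i _ hi => hkk i l hi) (by simp)
      simp [e, tack, tackRel, Fintype.sum_sum_type, hsum] at this
      linear_combination this
    · rintro (j | l | l | l | _) hj
      · simp [e, tackRel]
      · simp [e, tackRel]
      · exact absurd hj (T.not_k_le_d l)
      · exact absurd hj (T.not_c_le_d l)
      · simp [e, tackRel]
  have key (i : ι) : ∀ u, Φ u u = Φ (.inr (.inr i)) (.inr (.inr i)) := by
    rintro (j | j | j)
    · rw [← h2, h3 j i]
    · rw [← h1, h3 j i]
    · exact h3 j i
  rintro (i | i | i) j
  all_goals exact (key i _).trans (key i j).symm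

/-- Generator `i` goes to `q i`; back, both `p i` and `q i` go to generator `i`, and `k i` goes to
`0`. The new relations are thereby sent to `0`, and the round trip on the tacked module changes `p
i` by `q i - p i` and `k i` by `-k i`, both of which are relations after a shift by `2ε`. -/
lemma interleaved_tack : Interleaved ε D.toPersMod (D.tack T).toPersMod := by
  have hrel (j) {s} (h : (D.tack T).rdeg j ≤ s) : D.tackRel j ∈ (D.tack T).rels s :=
    (D.tack T).rel_mem_rels h
  let A (i : ι) : ι ⊕ ι ⊕ ι → K := Pi.single (.inr (.inl i)) 1
  let B : ι ⊕ ι ⊕ ι → ι → K := Sum.elim (Pi.single · 1) (Sum.elim (Pi.single · 1) 0)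
  have hsum (w : ι → K) : ∑ i, w i • A i = (Sum.elim 0 (Sum.elim w 0) : ι ⊕ ι ⊕ ι → K) := by
    ext (l | l | l) <;> simp [A, Pi.single_apply]
  have hsum' (w : ι → K) : ∑ i, w i • (Pi.single i 1 : ι → K) = w := by
    ext
    simp [Pi.single_apply]
  refine D.interleaved_of_matrices (D.tack T) A B ?_ ?_ ?_ ?_ ?_ ?_
  · intro i
    exact single_mem_below (D.tack T).deg (i := .inr (.inl i)) (T.q_le i) (1 : K)
  · rintro (i | i | i)
    · exact single_mem_below _ ((T.a_le_p i).trans (le_addDiag _ ε)) (1 : K)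
    · exact single_mem_below _ ((T.a_le_q i).trans (le_addDiag _ ε)) (1 : K)
    · exact Submodule.zero_mem _
  · intro j
    rw [hsum]
    exact hrel (.inl j) le_rfl
  · have hB (v : ι ⊕ ι ⊕ ι → K) : ∑ u, v u • B u =
        (fun i => v (.inl i)) + fun i => v (.inr (.inl i)) := by
      simp only [B, Fintype.sum_sum_type, Sum.elim_inl, Sum.elim_inr, Pi.zero_apply, smul_zero,
        Finset.sum_const_zero, add_zero]
      rw [hsum' fun i => v (.inl i), hsum' fun i => v (.inr (.inl i))]
    intro j
    rw [hB]
    obtain j | j | j | j | _ := j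
    · have h : ((fun i => (D.tack T).rel (.inl j) (.inl i)) +
          fun i => (D.tack T).rel (.inl j) (.inr (.inl i))) = D.rel j := by
        ext i
        simp [tack, tackRel]
      rw [h]
      exact D.rel_mem_rels (le_addDiag_addDiag _ _)
    all_goals
      convert Submodule.zero_mem _ using 1
      ext i
      simp [tack, tackRel, Pi.single_apply]
  · intro i
    have : ∑ u, A i u • B u = Pi.single i 1 := by
      rw [Finset.sum_eq_single (.inr (.inl i))]
      · simp [A, B]
      · intro u _ hu
        simp [A, hu]
      · simp
    rw [this, sub_self]
    exact Submodule.zero_mem _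
  · rintro (i | i | i)
    · have h : (Sum.elim 0 (Sum.elim (B (.inl i)) 0) : ι ⊕ ι ⊕ ι → K) - Pi.single (.inl i) 1 =
          D.tackRel (.inr (.inl i)) := by
        ext (l | l | l) <;> simp [B, Pi.single_apply, tackRel]
      rw [hsum, ← addDiag_addDiag, h]
      exact hrel _ ((addDiag_mono ε (T.a_le_p i)).trans (le_addDiag _ ε))
    · rw [hsum]
      convert Submodule.zero_mem _ using 1
      ext (l | l | l) <;> simp [B, Pi.single_apply]
    · have h : (Sum.elim 0 (Sum.elim (B (.inr (.inr i))) 0) : ι ⊕ ι ⊕ ι → K) -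
          Pi.single (.inr (.inr i)) 1 = -D.tackRel (.inr (.inr (.inl i))) := by
        ext (l | l | l) <;> simp [B, Pi.single_apply, tackRel]
      rw [hsum, ← addDiag_addDiag, h]
      exact Submodule.neg_mem _ (hrel _ (le_addDiag (addDiag (T.k i) ε) ε))

/-- A module whose generators are connected has only trivial idempotent endomorphisms. -/
theorem tack_idempotent [Nonempty ι] (φ : (D.tack T).toPersMod ⟶ (D.tack T).toPersMod)
    (hφ : φ ≫ φ = φ) : φ = 0 ∨ φ = 𝟙 _ :=
  eq_zero_or_eq_id_of_idempotent T.injective (D.tack_diag T) (.inr (.inr (Classical.arbitrary ι)))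
    (D.tack_rels_apply T _) φ hφ

lemma id_tack_ne_zero [Nonempty ι] : 𝟙 (D.tack T).toPersMod ≠ 0 :=
  id_ne_zero (.inr (.inr (Classical.arbitrary ι))) (D.tack_rels_apply T _)

end Presentation

end PersMod

/-! ### Choosing the degrees of the new generators and relations -/

namespace PersMod

variable {n : ℕ}

lemma eventually_mul_lt (c : ℝ) {ε : ℝ} (hε : 0 < ε) :
    ∀ᶠ τ : ℝ in nhdsWithin 0 (Set.Ioi 0), τ * c < ε := by
  have h : Filter.Tendsto (fun τ : ℝ => τ * c) (nhds 0) (nhds (0 * c)) :=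
    (continuous_id.mul continuous_const).tendsto 0
  rw [zero_mul] at h
  exact nhdsWithin_le_nhds (h (Iio_mem_nhds hε))

/-- For a pair with distinct values of `f`, a small `τ` cannot close the gap; for a pair with equal
values, any `τ > 0` separates because `N` is injective. -/
lemma exists_injective_perturbation {σ : Type} [Finite σ] (f : σ → ℝ) {N : σ → ℕ}
    (hN : Function.Injective N) {ε : ℝ} (hε : 0 < ε) :
    ∃ τ : ℝ, 0 < τ ∧ (∀ u, τ * N u < ε) ∧ Function.Injective fun u => f u + τ * N u := by
  have h1 (u v : σ) : ∀ᶠ τ : ℝ in nhdsWithin 0 (Set.Ioi 0),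
      f u + τ * N u = f v + τ * N v → u = v := by
    by_cases huv : u = v
    · simp [huv]
    have hne : (N u : ℝ) - N v ≠ 0 := sub_ne_zero.2 fun h => huv (hN (Nat.cast_injective h))
    by_cases hf : f u = f v
    · filter_upwards [self_mem_nhdsWithin] with τ (hτ : 0 < τ) h
      have : τ * ((N u : ℝ) - N v) = 0 := by linear_combination h - hf
      exact absurd this (mul_ne_zero hτ.ne' hne)
    · have hpos : 0 < |f u - f v| := abs_pos.2 (sub_ne_zero.2 hf)
      filter_upwards [eventually_mul_lt |(N u : ℝ) - N v| hpos, self_mem_nhdsWithin]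
        with τ hτ (hτ0 : 0 < τ) h
      have : f u - f v = -(τ * ((N u : ℝ) - N v)) := by linear_combination h
      rw [this, abs_neg, abs_mul, abs_of_pos hτ0] at hτ
      exact absurd hτ (lt_irrefl _)
  obtain ⟨τ, ⟨h, h'⟩, hτ⟩ := (((Filter.eventually_all.2 fun u => eventually_mul_lt (N u : ℝ) hε).and
    (Filter.eventually_all.2 fun u => Filter.eventually_all.2 (h1 u))).and
    self_mem_nhdsWithin).exists
  exact ⟨τ, hτ, h, fun u v huv => h' u v huv⟩

lemma exists_separated_coordinates {ι : Type} [Fintype ι] (a : ι → ℝ) {ε : ℝ} (hε : 0 < ε) :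
    ∃ x y z : ι → ℝ, Function.Injective (Sum.elim x (Sum.elim y z)) ∧
      ∀ i, a i ≤ x i ∧ x i < y i ∧ y i < z i ∧ z i < a i + ε := by
  let e := Fintype.equivFin ι
  -- Consecutive multiples for the three copies of `i` give `x i < y i < z i`, while the factor `3`
  -- keeps all weights distinct.
  let N : ι ⊕ ι ⊕ ι → ℕ := Sum.elim (fun i => 3 * (e i : ℕ))
    (Sum.elim (fun i => 3 * (e i : ℕ) + 1) fun i => 3 * (e i : ℕ) + 2)
  have he {i j : ι} (h : (e i : ℕ) = e j) : i = j := e.injective (Fin.ext h)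
  have hN : Function.Injective N := by
    rintro (i | i | i) (j | j | j) h <;> simp only [N, Sum.elim_inl, Sum.elim_inr] at h
    all_goals first | (exfalso; omega) | rw [he (show (e i : ℕ) = e j by omega)]
  obtain ⟨τ, hτ, hlt, hinj⟩ := exists_injective_perturbation (Sum.elim a (Sum.elim a a)) hN hε
  refine ⟨fun i => a i + τ * (3 * (e i : ℕ) : ℕ), fun i => a i + τ * (3 * (e i : ℕ) + 1 : ℕ),
    fun i => a i + τ * (3 * (e i : ℕ) + 2 : ℕ), ?_, fun i => ⟨?_, ?_, ?_, ?_⟩⟩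
  · convert hinj using 1
    ext (i | i | i) <;> rfl
  · exact le_add_of_nonneg_right (by positivity)
  · push_cast
    linarith
  · push_cast
    linarith
  · exact add_lt_add_right (hlt (.inr (.inr i))) (a i)

/-- A line of slope `-τ`, lowered beneath all the `b i`; for small `τ` its values on the finite set
of `x i` differ from `Y` by less than `ε`. As second coordinates, these turn the `k i` into an
antichain. -/
lemma exists_antitone_coordinates {ι : Type} [Finite ι] (x b : ι → ℝ) {ε : ℝ} (hε : 0 < ε) :
    ∃ (y : ι → ℝ) (Y : ℝ), (∀ i, y i ≤ Y) ∧ (∀ i, Y < y i + ε) ∧ (∀ i, Y < b i) ∧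
      ∀ i j, x i < x j → y j < y i := by
  obtain ⟨m, hm⟩ := (Set.finite_range x).bddBelow
  obtain ⟨B, hB⟩ := (Set.finite_range b).bddBelow
  obtain ⟨τ, h, hτ : 0 < τ⟩ := ((Filter.eventually_all.2 fun i =>
    eventually_mul_lt (x i - m) hε).and self_mem_nhdsWithin).exists
  refine ⟨fun i => B - 1 - τ * (x i - m), B - 1, fun i => ?_, fun i => ?_, fun i => ?_,
    fun i j hij => ?_⟩
  · have : 0 ≤ τ * (x i - m) := mul_nonneg hτ.le (sub_nonneg.2 (hm ⟨i, rfl⟩))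
    linarith
  · linarith [h i]
  · linarith [hB ⟨i, rfl⟩]
  · have : τ * (x i - m) < τ * (x j - m) := mul_lt_mul_of_pos_left (by linarith) hτ
    linarith

/-- The point with two prescribed coordinates `u` and `v`, and the other coordinates those of
`z`. -/
def pt (k₀ k₁ : Fin n) (u v : ℝ) (z : RPoset n) : RPoset n :=
  fun k => if k = k₀ then u else if k = k₁ then v else z k

lemma pt_fst (k₀ k₁ : Fin n) (u v : ℝ) (z : RPoset n) : pt k₀ k₁ u v z k₀ = u := by simp [pt]

lemma pt_snd {k₀ k₁ : Fin n} (h : k₁ ≠ k₀) (u v : ℝ) (z : RPoset n) : pt k₀ k₁ u v z k₁ = v := by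
  simp [pt, h]

lemma pt_le_pt {k₀ k₁ : Fin n} {u v u' v' : ℝ} {z z' : RPoset n} (hu : u ≤ u') (hv : v ≤ v')
    (hz : ∀ k, z k ≤ z' k) : pt k₀ k₁ u v z ≤ pt k₀ k₁ u' v' z' := by
  intro k
  change pt k₀ k₁ u v z k ≤ pt k₀ k₁ u' v' z' k
  unfold pt
  split_ifs
  · exact hu
  · exact hv
  · exact hz k

lemma le_of_pt_le_pt {k₀ k₁ : Fin n} (hk : k₁ ≠ k₀) {u v u' v' : ℝ} {z z' : RPoset n}
    (h : pt k₀ k₁ u v z ≤ pt k₀ k₁ u' v' z') : u ≤ u' ∧ v ≤ v' := by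
  have h0 : pt k₀ k₁ u v z k₀ ≤ pt k₀ k₁ u' v' z' k₀ := h k₀
  have h1 : pt k₀ k₁ u v z k₁ ≤ pt k₀ k₁ u' v' z' k₁ := h k₁
  rw [pt_fst, pt_fst] at h0
  rw [pt_snd hk, pt_snd hk] at h1
  exact ⟨h0, h1⟩

lemma pt_self (k₀ k₁ : Fin n) (z : RPoset n) : pt k₀ k₁ (z k₀) (z k₁) z = z := by
  funext k
  unfold pt
  split_ifs with h h' <;> simp [*]

lemma addDiag_pt (k₀ k₁ : Fin n) (u v r : ℝ) (z : RPoset n) :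
    addDiag (pt k₀ k₁ u v z) r = pt k₀ k₁ (u + r) (v + r) (addDiag z r) := by
  funext k
  unfold addDiag pt
  split_ifs <;> rfl

/-- All comparisons that must fail are decided by two coordinates. Near `a i`, the first coordinates
`x i < y i < z i` increase while `p i` is raised by `ε / 2` in the second, making `p i` and `q i`
incomparable. The `k i` lie below every `a j` in the second coordinate, and to the right of `p i`,
`q i` in the first. The point `d` is to the right of all `c i` and below them. In the remaining
coordinates, `max (a i k) 0` lets `c i` dominate both `a i` and the value `0` used for `k i`. -/
lemma exists_tackData (hn : 2 ≤ n) {ι : Type} [Fintype ι] (a : ι → RPoset n) {ε : ℝ≥0}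
    (hε : 0 < ε) : Nonempty (TackData n a ε) := by
  have hε' : (0 : ℝ) < ε := hε
  let k₀ : Fin n := ⟨0, by omega⟩
  let k₁ : Fin n := ⟨1, by omega⟩
  have hk : k₁ ≠ k₀ := by simp [k₀, k₁]
  obtain ⟨x, y, z, hinj, hxyz⟩ := exists_separated_coordinates (fun i => a i k₀) hε'
  obtain ⟨w, Y, hwY, hYw, hYa, hw⟩ := exists_antitone_coordinates z (fun i => a i k₁) hε'
  obtain ⟨X, hX⟩ := (Set.finite_range z).bddAbove
  replace hX (i) : z i ≤ X := hX ⟨i, rfl⟩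
  have ha (i) : a i = pt k₀ k₁ (a i k₀) (a i k₁) (a i) := (pt_self _ _ _).symm
  have ha' (i) : addDiag (a i) ε = pt k₀ k₁ (a i k₀ + ε) (a i k₁ + ε) (addDiag (a i) ε) :=
    (pt_self _ _ _).symm
  have hx (i) := (hxyz i).1
  have hxy (i) := (hxyz i).2.1
  have hyz (i) := (hxyz i).2.2.1
  have hz (i) := (hxyz i).2.2.2
  refine ⟨{
    p := fun i => pt k₀ k₁ (x i) (a i k₁ + ε / 2) (a i)
    q := fun i => pt k₀ k₁ (y i) (a i k₁) (a i)
    k := fun i => pt k₀ k₁ (z i) (w i) fun _ => 0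
    c := fun i => pt k₀ k₁ (z i) (a i k₁ + ε / 2) fun k => max (a i k) 0
    d := pt k₀ k₁ (X + 1) Y fun _ => 0
    a_le_p := fun i => (ha i).le.trans (pt_le_pt (hx i) (by linarith) fun k => le_rfl)
    p_le := fun i => (pt_le_pt (by linarith [hxy i, hyz i, hz i]) (by linarith)
      (le_addDiag (a i) ε)).trans (ha' i).ge
    a_le_q := fun i => (ha i).le.trans (pt_le_pt ((hx i).trans (hxy i).le) le_rfl fun k => le_rfl)
    q_le := fun i => (pt_le_pt (by linarith [hyz i, hz i]) (by linarith)
      (le_addDiag (a i) ε)).trans (ha' i).ge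
    p_le_c := fun i => pt_le_pt (by linarith [hxy i, hyz i]) le_rfl fun k => le_max_left _ _
    q_le_c := fun i => pt_le_pt (hyz i).le (by linarith) fun k => le_max_left _ _
    k_le_c := fun i => pt_le_pt le_rfl (by linarith [hwY i, hYa i]) fun k => le_max_right _ _
    k_le_d := fun i => pt_le_pt (by linarith [hX i]) (hwY i) fun k => le_rfl
    not_a_le_c := fun i h => by linarith [(le_of_pt_le_pt hk ((ha' i).ge.trans h)).1, hz i]
    not_k_le_c := fun i h => by
      linarith [(le_of_pt_le_pt hk ((addDiag_pt _ _ _ _ _ _).ge.trans h)).1]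
    not_k_le_d := fun i h => by
      linarith [(le_of_pt_le_pt hk ((addDiag_pt _ _ _ _ _ _).ge.trans h)).2, hYw i]
    not_d_le_c := fun i h => by linarith [(le_of_pt_le_pt hk h).1, hX i]
    not_c_le_d := fun i h => by linarith [(le_of_pt_le_pt hk h).2, hYa i]
    not_p_le_q := fun i h => by linarith [(le_of_pt_le_pt hk h).2]
    not_q_le_p := fun i h => by linarith [(le_of_pt_le_pt hk h).1, hxy i]
    not_p_le_k := fun i h => by linarith [(le_of_pt_le_pt hk h).2, hwY i, hYa i]
    not_q_le_k := fun i h => by linarith [(le_of_pt_le_pt hk h).2, hwY i, hYa i]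
    not_k_le_p := fun i h => by linarith [(le_of_pt_le_pt hk h).1, hxy i, hyz i]
    not_k_le_q := fun i h => by linarith [(le_of_pt_le_pt hk h).1, hyz i]
    eq_of_k_le := fun i j h => ?_
    injective := ?_ }⟩
  · obtain ⟨h0, h1⟩ := le_of_pt_le_pt hk h
    have hzz : z i = z j := h0.antisymm (not_lt.1 fun hlt => (hw i j hlt).not_ge h1)
    exact Sum.inr_injective (Sum.inr_injective (@hinj (.inr (.inr i)) (.inr (.inr j)) hzz))
  · refine Function.Injective.of_comp (f := fun s : RPoset n => s k₀) ?_
    convert hinj using 1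
    ext (i | i | i)
    · exact pt_fst k₀ k₁ (x i) (a i k₁ + ε / 2) (a i)
    · exact pt_fst k₀ k₁ (y i) (a i k₁) (a i)
    · exact pt_fst k₀ k₁ (z i) (w i) fun _ => 0

end PersMod

/-! ### Density of robust modules, and the theorem -/

namespace PersMod

variable {K : Type u} [Field K] {n : ℕ}

/-- Tacking needs at least one generator to yield a non-zero module. The zero module is therefore
presented by one generator killed in its own degree. -/
lemma IsFP.exists_presentation_nonempty {M : PersMod K n} (hM : M.IsFP) :
    ∃ (ι κ : Type) (_ : Fintype ι) (_ : Finite κ) (_ : Nonempty ι) (D : Presentation K n ι κ),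
      Nonempty (M ≅ D.toPersMod) := by
  obtain ⟨p, q, D, ⟨e⟩⟩ := hM.exists_presentation
  rcases Nat.eq_zero_or_pos p with rfl | hp
  · let D₀ : Presentation K n Unit Unit :=
      { deg := fun _ => (fun _ => 0 : Fin n → ℝ)
        rdeg := fun _ => (fun _ => 0 : Fin n → ℝ)
        rel := fun _ => Pi.single () 1
        rel_mem := fun _ _ _ => le_rfl }
    have h : IsZero D.toPersMod := (IsZero.iff_id_eq_zero _).2 (D.hom_ext fun i => i.elim0)
    have h₀ : IsZero D₀.toPersMod := (IsZero.iff_id_eq_zero _).2 <| D₀.hom_ext fun _ =>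
      (Presentation.gen_eq_comb ()).trans (D₀.comb_rel ())
    exact ⟨_, _, inferInstance, inferInstance, inferInstance, D₀, ⟨e ≪≫ h.iso h₀⟩⟩
  · exact ⟨_, _, inferInstance, inferInstance, ⟨⟨0, hp⟩⟩, D, ⟨e⟩⟩

/-- Arbitrarily close to any finitely presentable module, there is one all of whose neighbours are
close to one of their summands, for any decomposition into summands. -/
theorem IsFP.exists_interleaved_summand (hn : 2 ≤ n) {M : PersMod K n} (hM : M.IsFP) {ε : ℝ≥0}
    (hε : 0 < ε) : ∃ M' : PersMod K n, M'.IsFP ∧ Interleaved ε M M' ∧ ∃ γ : ℝ≥0, 0 < γ ∧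
      ∀ (δ : ℝ≥0), δ ≤ γ → ∀ (N : PersMod K n) (k : ℕ) (X : Fin k → PersMod K n),
        Nonempty (N ≅ ⨁ X) → Interleaved δ M' N → ∃ i, Interleaved δ M' (X i) := by
  classical
  obtain ⟨ι, κ, _, _, _, D, ⟨e⟩⟩ := hM.exists_presentation_nonempty
  obtain ⟨T⟩ := exists_tackData hn D.deg hε
  exact ⟨(D.tack T).toPersMod, (D.tack T).isFP, (D.interleaved_tack T).congr e.symm (Iso.refl _),
    (D.tack T).exists_interleaved_summand (D.tack_idempotent T) (D.id_tack_ne_zero T)⟩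

end PersMod

namespace FPSpace

variable {K : Type u} [Field K] {n : ℕ}

lemma subset_decomposables (F : Set (FPSpace K n)) : F ⊆ decomposables F := by
  intro x hx
  obtain ⟨M, hM, rfl⟩ := x.exists_rep
  exact ⟨M, hM, rfl, 1, fun _ => M, fun _ => ⟨hM, hx⟩,
    ⟨(biproductUniqueIso fun _ : Fin 1 => M).symm⟩⟩

/-- Move from `x` to a robust `M'` without leaving the interior, approximate `M'` by a decomposable
`N`, and pass to a summand of `N` close to `M'`. Each of the two moves costs less than `r / 2`. -/
theorem interior_closure_decomposables_subset (hn : 2 ≤ n) (F : Set (FPSpace K n)) :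
    interior (closure (decomposables F)) ⊆ closure F := by
  intro x hx
  refine mem_closure_iff.2 fun r hr => ?_
  obtain ⟨ρ, hρ, hball⟩ := exists_ball_subset isOpen_interior x hx
  obtain ⟨M, hM, rfl⟩ := x.exists_rep
  obtain ⟨ε, hε, hε'⟩ := exists_between (lt_min (half_pos hr) hρ)
  obtain ⟨M', hM', hMM', γ, hγ, hstab⟩ := hM.exists_interleaved_summand hn hε
  have hd : dist (mk M hM) (mk M' hM') ≤ ε := iInf₂_le ε hMM'
  have hcl : mk M' hM' ∈ closure (decomposables F) := interior_subset <| hball <|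
    hd.trans_lt (ENNReal.coe_lt_coe.2 (hε'.trans_le (min_le_right _ _)))
  obtain ⟨y, ⟨N, hN, rfl, k, X, hX, e⟩, hy⟩ :=
    mem_closure_iff.1 hcl (min γ (r / 2)) (lt_min hγ (half_pos hr))
  obtain ⟨δ, hδ, hδ'⟩ := PersMod.dI_lt_iff.1 hy
  rw [ENNReal.coe_lt_coe] at hδ'
  obtain ⟨i, hi⟩ := hstab δ (hδ'.le.trans (min_le_left _ _)) N k X e hδ
  obtain ⟨hXi, hF⟩ := hX i
  refine ⟨_, hF, (iInf₂_le (ε + δ) (hMM'.trans hi)).trans_lt (ENNReal.coe_lt_coe.2 ?_)⟩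
  calc ε + δ < r / 2 + r / 2 := add_lt_add (hε'.trans_le (min_le_left _ _))
        (hδ'.trans_le (min_le_right _ _))
    _ = r := add_halves r

end FPSpace

end

theorem mainTheorem5 (K : Type u) [Field K] (n : ℕ) (hn : 2 ≤ n)
    (F : Set (FPSpace K n)) (hF : ∀ x ∈ F, x.IsIndecomposable) :
    interior (closure (FPSpace.decomposables F)) = interior (closure F) ∧
      (Dense (FPSpace.decomposables F) → Dense F) := by
  have h := FPSpace.interior_closure_decomposables_subset hn F
  refine ⟨Set.Subset.antisymm (interior_maximal h isOpen_interior)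
    (interior_mono (closure_mono (FPSpace.subset_decomposables F))), fun hd => ?_⟩
  rw [hd.closure_eq, interior_univ, Set.univ_subset_iff] at h
  exact dense_iff_closure_eq.2 h
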